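/- Let $H$ be a complex Hilbert space with norm $\|\cdot\|$, let $T\in(0,\infty]$, and let $\mathcal A:D(\mathcal A)\subset H\to H$ be a nonnegative selfadjoint operator such that $-\mathcal A$ generates a bounded analytic contraction $C_0$-semigroup $(e^{-t\mathcal A})_{t\ge 0}$ on $H$. For $0\le t<T$ let $\mathcal B(t)$ be a linear operator in $H$ with $D(\mathcal A)\subset D(\mathcal B(t))$. Assume: (a) there are $C_1>0$ and $C_2\ge 0$ such that $\|\mathcal B(t)f\|\le C_1\|\mathcal A f\|+C_2\|f\|$ for all $f\in D(\mathcal A)$ and $0\le t<T$; (b) there is $C>0$ such that for all $\varphi\in C((0,T);D(\mathcal A))$ and $0<s\le t<T$, $$\|\mathcal B(t)\varphi(t)-\mathcal B(s)\varphi(s)\|\le C(t-s)\big(\|\mathcal A\varphi(t)\|+\|\varphi(t)\|\big)+C\big(\|\mathcal A\varphi(t)-\mathcal A\varphi(s)\|+\|\varphi(t)-\varphi(s)\|\big).$$ For $S\in(0,\infty]$ let $Y_S$ be the set of $\varphi\in C((0,S);H)$ with $$\|\varphi\|_{Y_S}:=\sup_{0<t<S}e^{-t}\|\varphi(t)\|+\|d\varphi/dt\|_{L^2(0,S;H)}+\|\mathcal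 A\varphi\|_{L^2(0,S;H)}<\infty .$$ For $v_0\in D(\mathcal A^{1/2})$ and $0<S\le T$, a strong solution in $Y_S$ of $$\tfrac{d}{dt}v+(\mathcal A+\mathcal B(t))v=0\ \text{ on }(0,S),\qquad v|_{t=0}=v_0, \tag{1}$$ is a $v\in Y_S$ with $\|dv/dt+(\mathcal A+\mathcal B)v\|_{L^2(0,S;H)}=0$ and $\lim_{t\to0+}v(t)=v_0$ in $H$. Call $C_{\mathcal A}>0$ a maximal regularity constant of $\mathcal A$ if for all $S\in(0,\infty]$, $F\in L^2(0,S;H)$ and $V_0\in D(\mathcal A^{1/2})$, every solution $V\in C((0,S);H)$ of $dV/dt+\mathcal A V=F$ a.e. on $(0,S)$, $\lim_{t\to0+}V(t)=V_0$, with $dV/dt,\mathcal A V\in L^2(0,S;H)$, satisfies $$\|dV/dt\|_{L^2(0,S;H)}+\|\mathcal A V\|_{L^2(0,S;H)}\le\sqrt2\,\|\mathcal A^{1/2}V_0\|+C_{\mathcal A}\|F\|_{L^2(0,S;H)} .$$ Then a maximal regularity constant exists, and for every maximal regularity constant $C_{\mathcal A}$ with $$C_1(C_{\mathcal A}+1)<\frac1{4\sqrt2}$$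 the following hold. (i) If $T<\infty$ and $C_2>0$, put $$T_*=\min\Big\{T,\ \tfrac12\log\Big(1+\frac1{16C_2^2(C_{\mathcal A}+1)^2}\Big)\Big\}.$$ For each $v_0\in D(\mathcal A^{1/2})$ there is a unique strong solution $v$ of (1) in $Y_{T_*}$; moreover $\|v\|_{Y_{T_*}}\le 2\|v_0\|+2\sqrt2\,\|\mathcal A^{1/2}v_0\|$ and, for each $0<t<T_*$, $$v(t)=e^{-t\mathcal A}v_0-\int_0^te^{-(t-\tau)\mathcal A}\mathcal B(\tau)v(\tau)\,d\tau . \tag{2}$$ (ii) If $T=\infty$ and $C_2=0$, then for each $v_0\in D(\mathcal A^{1/2})$ there is a unique strong solution $v$ of (1) in $Y_\infty$; moreover $\|v\|_{Y_\infty}\le 2\|v_0\|+2\sqrt2\,\|\mathcal A^{1/2}v_0\|$, and (2) holds for each $0<t<\infty$. -/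

import Mathlib

open MeasureTheory Set Filter Topology

noncomputable section

/-- The time interval `(0, T)` for `T ∈ (0, ∞]`. -/
def timeInterval (T : EReal) : Set ℝ := {t : ℝ | 0 < t ∧ (t : EReal) < T}

/-- Lebesgue measure on `(0, T)`. -/
def timeMeasure (T : EReal) : Measure ℝ := volume.restrict (timeInterval T)

/-- The open sector `{z ≠ 0 : |arg z| < δ}`. -/
def openSector (δ : ℝ) : Set ℂ := {z : ℂ | z ≠ 0 ∧ |z.arg| < δ}

section

variable {H : Type*} [NormedAddCommGroup H] [InnerProductSpace ℂ H]

/-! ### Unbounded operators -/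

open Classical in
/-- `A x` for `x ∈ D(A)` (and `0` for `x ∉ D(A)`); it is only used where `x ∈ D(A)` is known. -/
def opApply (A : H →ₗ.[ℂ] H) (x : H) : H := if h : x ∈ A.domain then A ⟨x, h⟩ else 0

/-- `⟨A x, x⟩ ≥ 0` on `D(A)` (for a selfadjoint `A` this number is real). -/
def IsNonnegOp (A : H →ₗ.[ℂ] H) : Prop := ∀ x : A.domain, 0 ≤ (inner ℂ (A x) (x : H)).re

/-- `S` is a nonnegative selfadjoint square root of `A`: `S ∘ S = A`, including the equality
of domains `D(A) = {x ∈ D(S) : S x ∈ D(S)}`. -/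
structure IsNonnegSqrt [CompleteSpace H] (A S : H →ₗ.[ℂ] H) : Prop where
  selfAdjoint : IsSelfAdjoint S
  nonneg : IsNonnegOp S
  sq : ∀ x z : H, (x, z) ∈ A.graph ↔ ∃ y : H, (x, y) ∈ S.graph ∧ (y, z) ∈ S.graph

open Classical in
/-- `A^{1/2}`: the nonnegative selfadjoint square root, which exists and is unique for every
nonnegative selfadjoint `A`. -/
def opSqrt [CompleteSpace H] (A : H →ₗ.[ℂ] H) : H →ₗ.[ℂ] H :=
  if h : ∃ S, IsNonnegSqrt A S then h.choose else 0

/-! ### Semigroups -/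

variable (H) in
/-- A `C₀`-semigroup of bounded operators; only the values at `t ≥ 0` are relevant. -/
structure C0Semigroup where
  toFun : ℝ → H →L[ℂ] H
  map_zero : toFun 0 = 1
  map_add : ∀ s t : ℝ, 0 ≤ s → 0 ≤ t → toFun (s + t) = toFun s * toFun t
  tendsto_zero : ∀ x : H, Tendsto (fun t => toFun t x) (𝓝[>] 0) (𝓝 x)

/-- `G` is the infinitesimal generator of the semigroup:
`x ∈ D(G)` and `G x = y` iff `(E(h) x - x) / h → y` as `h → 0+`. -/
def C0Semigroup.IsGenerator (E : C0Semigroup H) (G : H →ₗ.[ℂ] H) : Prop :=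
  ∀ x y : H, (x, y) ∈ G.graph ↔
    Tendsto (fun h : ℝ => (h⁻¹ : ℝ) • (E.toFun h x - x)) (𝓝[>] 0) (𝓝 y)

def C0Semigroup.IsContraction (E : C0Semigroup H) : Prop := ∀ t : ℝ, 0 ≤ t → ‖E.toFun t‖ ≤ 1

/-- Bounded analytic semigroup: `E` extends to a holomorphic semigroup on an open sector, strongly
continuous at `0` and bounded on every strictly smaller sector. -/
def C0Semigroup.IsBoundedAnalytic (E : C0Semigroup H) : Prop :=
  ∃ δ : ℝ, 0 < δ ∧ δ ≤ Real.pi / 2 ∧ ∃ Z : ℂ → H →L[ℂ] H,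
    (∀ t : ℝ, 0 < t → Z (t : ℂ) = E.toFun t) ∧
    DifferentiableOn ℂ Z (openSector δ) ∧
    (∀ z ∈ openSector δ, ∀ w ∈ openSector δ, Z (z + w) = Z z * Z w) ∧
    ∀ δ' : ℝ, 0 < δ' → δ' < δ →
      (∀ x : H, Tendsto (fun z => Z z x) (𝓝[openSector δ'] 0) (𝓝 x)) ∧
      ∃ M : ℝ, ∀ z ∈ openSector δ', ‖Z z‖ ≤ M

/-! ### The function spaces in time -/

/-- `ψ` is the time derivative of `φ` on `(0, T)`: `φ` is locally absolutely continuous with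
(a.e. and distributional) derivative `ψ`. -/
def IsTimeDeriv (T : EReal) (φ ψ : ℝ → H) : Prop :=
  LocallyIntegrableOn ψ (timeInterval T) ∧
    ∀ s ∈ timeInterval T, ∀ t ∈ timeInterval T, φ t - φ s = ∫ τ in s..t, ψ τ

open Classical in
/-- `dφ/dt` on `(0, T)`, determined up to a null set whenever it exists. -/
def timeDeriv (T : EReal) (φ : ℝ → H) : ℝ → H :=
  if h : ∃ ψ, IsTimeDeriv T φ ψ then h.choose else 0

/-- `φ ∈ C((0,T); H)`, `dφ/dt ∈ L²(0,T;H)`, `φ(t) ∈ D(A)` for a.e. `t` and `Aφ ∈ L²(0,T;H)`. -/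
structure HasL2Regularity (A : H →ₗ.[ℂ] H) (T : EReal) (φ : ℝ → H) : Prop where
  continuousOn : ContinuousOn φ (timeInterval T)
  differentiable : ∃ ψ, IsTimeDeriv T φ ψ
  memLp_deriv : MemLp (timeDeriv T φ) 2 (timeMeasure T)
  mem_domain : ∀ᵐ t ∂(timeMeasure T), φ t ∈ A.domain
  memLp_op : MemLp (fun t => opApply A (φ t)) 2 (timeMeasure T)

/-- `sup_{0<t<T} e^{-t} ‖φ(t)‖ + ‖dφ/dt‖_{L²(0,T;H)} + ‖Aφ‖_{L²(0,T;H)}`. -/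
def normY (A : H →ₗ.[ℂ] H) (T : EReal) (φ : ℝ → H) : ENNReal :=
  (⨆ t ∈ timeInterval T, ENNReal.ofReal (Real.exp (-t)) * ‖φ t‖ₑ)
    + eLpNorm (timeDeriv T φ) 2 (timeMeasure T)
    + eLpNorm (fun t => opApply A (φ t)) 2 (timeMeasure T)

/-- `φ ∈ Y_T`; only the restriction of `φ` to `(0, T)` matters. -/
def MemY (A : H →ₗ.[ℂ] H) (T : EReal) (φ : ℝ → H) : Prop :=
  HasL2Regularity A T φ ∧ normY A T φ < ⊤

/-- `C` is a constant of maximal `L²`-regularity for `A`, uniform in `T ∈ (0, ∞]`: every solution of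
`V' + A V = F` on `(0, T)`, `V(0) = V₀ ∈ D(A^{1/2})`, with `F ∈ L²(0,T;H)` satisfies
`‖V'‖_{L²} + ‖A V‖_{L²} ≤ √2 ‖A^{1/2} V₀‖ + C ‖F‖_{L²}`. -/
def IsMaxRegConst [CompleteSpace H] (A : H →ₗ.[ℂ] H) (C : ℝ) : Prop :=
  0 < C ∧ ∀ T : EReal, 0 < T → ∀ F : ℝ → H, MemLp F 2 (timeMeasure T) →
    ∀ V₀ : (opSqrt A).domain, ∀ V : ℝ → H, HasL2Regularity A T V →
      (∀ᵐ t ∂(timeMeasure T), timeDeriv T V t + opApply A (V t) = F t) →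
      Tendsto V (𝓝[>] 0) (𝓝 (V₀ : H)) →
      eLpNorm (timeDeriv T V) 2 (timeMeasure T)
          + eLpNorm (fun t => opApply A (V t)) 2 (timeMeasure T)
        ≤ ENNReal.ofReal (Real.sqrt 2 * ‖opSqrt A V₀‖)
          + ENNReal.ofReal C * eLpNorm F 2 (timeMeasure T)

/-! ### The evolution equation -/

/-- `φ ∈ C((0,T); D(A))`, with the graph norm on `D(A)`. -/
def ContinuousInDomain (A : H →ₗ.[ℂ] H) (T : EReal) (φ : ℝ → H) : Prop :=
  (∀ t ∈ timeInterval T, φ t ∈ A.domain) ∧ ContinuousOn φ (timeInterval T) ∧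
    ContinuousOn (fun t => opApply A (φ t)) (timeInterval T)

/-- Relative boundedness: `‖B(t) f‖ ≤ C₁ ‖A f‖ + C₂ ‖f‖` for `f ∈ D(A)` and `0 ≤ t < T`. -/
def RelativelyBounded (A : H →ₗ.[ℂ] H) (B : ℝ → H →ₗ.[ℂ] H) (T : EReal) (C₁ C₂ : ℝ) : Prop :=
  ∀ t : ℝ, 0 ≤ t → (t : EReal) < T → ∀ f ∈ A.domain,
    ‖opApply (B t) f‖ ≤ C₁ * ‖opApply A f‖ + C₂ * ‖f‖

/-- The time-regularity condition on `t ↦ B(t)`. -/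
def TimeRegular (A : H →ₗ.[ℂ] H) (B : ℝ → H →ₗ.[ℂ] H) (T : EReal) : Prop :=
  ∃ C : ℝ, 0 < C ∧ ∀ φ : ℝ → H, ContinuousInDomain A T φ →
    ∀ s t : ℝ, 0 < s → s ≤ t → (t : EReal) < T →
      ‖opApply (B t) (φ t) - opApply (B s) (φ s)‖
        ≤ C * (t - s) * (‖opApply A (φ t)‖ + ‖φ t‖)
          + C * (‖opApply A (φ t) - opApply A (φ s)‖ + ‖φ t - φ s‖)

/-- `v` is a strong solution in `Y_T` of `v' + (A + B(t)) v = 0` on `(0, T)`, `v(0) = v₀`. -/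
structure IsStrongSolution (A : H →ₗ.[ℂ] H) (B : ℝ → H →ₗ.[ℂ] H) (T : EReal) (v₀ : H)
    (v : ℝ → H) : Prop where
  memY : MemY A T v
  equation : ∀ᵐ t ∂(timeMeasure T), timeDeriv T v t + opApply (A + B t) (v t) = 0
  initial : Tendsto v (𝓝[>] 0) (𝓝 v₀)

/-- `v(t) = E(t) v₀ - ∫₀ᵗ E(t - τ) B(τ) v(τ) dτ` for `0 < t < T`, with a convergent integral. -/
def SatisfiesDuhamel (E : C0Semigroup H) (B : ℝ → H →ₗ.[ℂ] H) (T : EReal) (v₀ : H)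
    (v : ℝ → H) : Prop :=
  ∀ t ∈ timeInterval T,
    IntervalIntegrable (fun τ => E.toFun (t - τ) (opApply (B τ) (v τ))) volume 0 t ∧
    v t = E.toFun t v₀ - ∫ τ in (0 : ℝ)..t, E.toFun (t - τ) (opApply (B τ) (v τ))

end

/-- `T_* = min {T, (1/2) log (1 + 1 / (16 C₂² (C_A + 1)²))}`. -/
def existenceTime (T : EReal) (C₂ CA : ℝ) : EReal :=
  min T ((1 / 2 * Real.log (1 + 1 / (16 * C₂ ^ 2 * (CA + 1) ^ 2)) : ℝ) : EReal)

end

set_option linter.unusedSectionVars false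

noncomputable section

variable {H : Type*} [NormedAddCommGroup H] [InnerProductSpace ℂ H]

/-! ### Unbounded selfadjoint operators -/

section

variable {A : H →ₗ.[ℂ] H}

lemma opApply_of_mem {x : H} (h : x ∈ A.domain) : opApply A x = A ⟨x, h⟩ := dif_pos h

lemma mem_graph_iff_opApply {x y : H} :
    (x, y) ∈ A.graph ↔ x ∈ A.domain ∧ opApply A x = y := by
  rw [LinearPMap.mem_graph_iff]
  constructor
  · rintro ⟨z, rfl, rfl⟩
    exact ⟨z.2, opApply_of_mem z.2⟩
  · rintro ⟨h, rfl⟩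
    exact ⟨⟨x, h⟩, rfl, (opApply_of_mem h).symm⟩

lemma opApply_mem_graph {x : H} (h : x ∈ A.domain) : (x, opApply A x) ∈ A.graph :=
  mem_graph_iff_opApply.2 ⟨h, rfl⟩

lemma opApply_add {x y : H} (hx : x ∈ A.domain) (hy : y ∈ A.domain) :
    opApply A (x + y) = opApply A x + opApply A y :=
  (mem_graph_iff_opApply.1 (A.graph.add_mem (opApply_mem_graph hx) (opApply_mem_graph hy))).2

lemma opApply_sub {x y : H} (hx : x ∈ A.domain) (hy : y ∈ A.domain) :
    opApply A (x - y) = opApply A x - opApply A y :=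
  (mem_graph_iff_opApply.1 (A.graph.sub_mem (opApply_mem_graph hx) (opApply_mem_graph hy))).2

lemma opApply_smul (c : ℂ) {x : H} (hx : x ∈ A.domain) :
    opApply A (c • x) = c • opApply A x :=
  (mem_graph_iff_opApply.1 (A.graph.smul_mem c (opApply_mem_graph hx))).2

lemma opApply_zero : opApply A 0 = 0 :=
  (mem_graph_iff_opApply.1 A.graph.zero_mem).2

lemma opApply_addOp {B : H →ₗ.[ℂ] H} {x : H} (hx : x ∈ A.domain) (hx' : x ∈ B.domain) :
    opApply (A + B) x = opApply A x + opApply B x := by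
  have h : x ∈ (A + B).domain := ⟨hx, hx'⟩
  rw [opApply_of_mem h, opApply_of_mem hx, opApply_of_mem hx']
  rfl

lemma IsNonnegOp.re_inner_opApply (h : IsNonnegOp A) {x : H} (hx : x ∈ A.domain) :
    0 ≤ (inner ℂ (opApply A x) x).re := by
  rw [opApply_of_mem hx]
  exact h ⟨x, hx⟩

lemma norm_add_smul_sq (x y : H) (l : ℝ) :
    ‖x + (l : ℂ) • y‖ ^ 2 = ‖x‖ ^ 2 + 2 * l * (inner ℂ y x).re + l ^ 2 * ‖y‖ ^ 2 := by
  rw [norm_add_sq (𝕜 := ℂ), inner_smul_right, norm_smul]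
  have h : (RCLike.re ((l : ℂ) * inner ℂ x y) : ℝ) = l * (inner ℂ y x).re := by
    rw [← inner_conj_symm y x]
    simp [inner_re_symm (𝕜 := ℂ) x y]
  rw [h, mul_pow]
  simp only [Complex.norm_real, Real.norm_eq_abs, sq_abs]
  ring

lemma norm_le_norm_add_smul {l : ℝ} (hl : 0 < l) {x y : H} (h : 0 ≤ (inner ℂ y x).re) :
    ‖x‖ ≤ ‖x + (l : ℂ) • y‖ := by
  refine (sq_le_sq₀ (norm_nonneg _) (norm_nonneg _)).1 ?_
  rw [norm_add_smul_sq]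
  nlinarith [mul_nonneg hl.le h, mul_nonneg (sq_nonneg l) (sq_nonneg ‖y‖)]


variable [CompleteSpace H]

lemma mem_graph_iff_of_isSelfAdjoint (hA : IsSelfAdjoint A) {x y : H} :
    (x, y) ∈ A.graph ↔ ∀ a ∈ A.domain, inner ℂ (opApply A a) x = inner ℂ a y := by
  conv_lhs => rw [← LinearPMap.isSelfAdjoint_def.1 hA,
    LinearPMap.adjoint_graph_eq_graph_adjoint hA.dense_domain, Submodule.mem_adjoint_iff]
  constructor
  · intro h a ha
    exact sub_eq_zero.1 (h a _ (opApply_mem_graph ha))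
  · intro h a b hab
    obtain ⟨ha, rfl⟩ := mem_graph_iff_opApply.1 hab
    exact sub_eq_zero.2 (h a ha)

lemma inner_opApply_left (hA : IsSelfAdjoint A) {x y : H} (hx : x ∈ A.domain)
    (hy : y ∈ A.domain) : inner ℂ (opApply A x) y = inner ℂ x (opApply A y) :=
  (mem_graph_iff_of_isSelfAdjoint hA).1 (opApply_mem_graph hy) x hx

/-- Solvability of `x + l A x = w` for a nonnegative selfadjoint operator `A` and `l > 0`. -/
lemma exists_add_smul_opApply_eq (hA : IsSelfAdjoint A) (hA0 : IsNonnegOp A) {l : ℝ} (hl : 0 < l)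
    (w : H) : ∃ x ∈ A.domain, x + (l : ℂ) • opApply A x = w := by
  let f : A.graph →ₗ[ℂ] H :=
    ((LinearMap.fst ℂ H H) + (l : ℂ) • (LinearMap.snd ℂ H H)) ∘ₗ A.graph.subtype
  have hf : ∀ p : A.graph, f p = p.1.1 + (l : ℂ) • p.1.2 := fun p => rfl
  have hfc : Continuous f := by
    have : (f : A.graph → H) = fun p => p.1.1 + (l : ℂ) • p.1.2 := rfl
    rw [this]
    fun_prop
  have hnn : ∀ p : A.graph, 0 ≤ (inner ℂ p.1.2 p.1.1).re := by
    rintro ⟨⟨x, y⟩, hp⟩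
    obtain ⟨hx, rfl⟩ := mem_graph_iff_opApply.1 hp
    exact hA0.re_inner_opApply hx
  have h1 : ∀ p : A.graph, ‖p.1.1‖ ≤ ‖f p‖ := fun p => norm_le_norm_add_smul hl (hnn p)
  have h2 : ∀ p : A.graph, ‖p.1.2‖ ≤ l⁻¹ * ‖f p‖ := by
    intro p
    have h : l * ‖p.1.2‖ ≤ ‖f p‖ := by
      refine (sq_le_sq₀ (by positivity) (norm_nonneg _)).1 ?_
      rw [hf, norm_add_smul_sq]
      nlinarith [mul_nonneg hl.le (hnn p), sq_nonneg ‖p.1.1‖]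
    rw [inv_mul_eq_div, le_div_iff₀ hl]
    linarith
  have hanti : AntilipschitzWith (max 1 (l⁻¹).toNNReal) f := by
    refine AddMonoidHomClass.antilipschitz_of_bound f fun p => ?_
    have hm : ((max 1 (l⁻¹).toNNReal : NNReal) : ℝ) = max 1 l⁻¹ := by
      rw [NNReal.coe_max, Real.coe_toNNReal _ (by positivity), NNReal.coe_one]
    rw [hm]
    change ‖(p : H × H)‖ ≤ _
    rw [Prod.norm_def]
    refine max_le ((h1 p).trans ?_) ((h2 p).trans ?_)
    · exact le_mul_of_one_le_left (norm_nonneg _) (le_max_left _ _)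
    · exact mul_le_mul_of_nonneg_right (le_max_right _ _) (norm_nonneg _)
  have hcl : IsClosed (A.graph : Set (H × H)) := hA.isClosed
  have : CompleteSpace A.graph := hcl.completeSpace_coe
  have hufc : UniformContinuous f :=
    uniformContinuous_of_continuousAt_zero f hfc.continuousAt
  have hclr : IsClosed (LinearMap.range f : Set H) := by
    rw [LinearMap.coe_range]
    exact hanti.isClosed_range hufc
  have htop : LinearMap.range f = ⊤ := by
    have : CompleteSpace (LinearMap.range f) := hclr.completeSpace_coe
    rw [← Submodule.orthogonal_eq_bot_iff, Submodule.eq_bot_iff]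
    intro y hy
    rw [Submodule.mem_orthogonal] at hy
    have hy' : ∀ a ∈ A.domain, inner ℂ a y + l * inner ℂ (opApply A a) y = 0 := by
      intro a ha
      have := hy _ ⟨⟨_, opApply_mem_graph ha⟩, rfl⟩
      rw [hf, inner_add_left, inner_smul_left, Complex.conj_ofReal] at this
      exact this
    have hl' : (l : ℂ) ≠ 0 := by exact_mod_cast hl.ne'
    have hg : (y, -(l : ℂ)⁻¹ • y) ∈ A.graph := by
      rw [mem_graph_iff_of_isSelfAdjoint hA]
      intro a ha
      rw [inner_smul_right]
      field_simp
      linear_combination hy' a ha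
    obtain ⟨hyd, hye⟩ := mem_graph_iff_opApply.1 hg
    have h0 := hA0.re_inner_opApply hyd
    have hyy : (inner ℂ y y : ℂ).re = ‖y‖ ^ 2 := inner_self_eq_norm_sq (𝕜 := ℂ) y
    rw [hye, inner_smul_left, ← Complex.ofReal_inv, ← Complex.ofReal_neg, Complex.conj_ofReal,
      Complex.re_ofReal_mul, hyy] at h0
    have h4 : ‖y‖ ^ 2 ≤ 0 := by
      have : 0 < l⁻¹ := by positivity
      nlinarith
    exact norm_eq_zero.1 (pow_eq_zero_iff two_ne_zero |>.1 (le_antisymm h4 (sq_nonneg _)))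
  have hw : w ∈ LinearMap.range f := htop ▸ Submodule.mem_top
  obtain ⟨⟨⟨x, y⟩, hp⟩, rfl⟩ := hw
  obtain ⟨hx, rfl⟩ := mem_graph_iff_opApply.1 hp
  exact ⟨x, hx, rfl⟩

lemma eq_of_add_smul_opApply_eq (hA0 : IsNonnegOp A) {l : ℝ} (hl : 0 < l) {x y : H}
    (hx : x ∈ A.domain) (hy : y ∈ A.domain)
    (h : x + (l : ℂ) • opApply A x = y + (l : ℂ) • opApply A y) : x = y := by
  have h1 := norm_le_norm_add_smul hl (hA0.re_inner_opApply (A.domain.sub_mem hx hy))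
  have h2 : x - y + (l : ℂ) • opApply A (x - y) = 0 := by
    rw [opApply_sub hx hy, smul_sub, sub_add_sub_comm, h, sub_self]
  rw [h2, norm_zero] at h1
  exact sub_eq_zero.1 (norm_le_zero_iff.1 h1)

/-- `J` is the resolvent `(1 + l A)⁻¹`. -/
structure IsResolvent (A : H →ₗ.[ℂ] H) (l : ℝ) (J : H →L[ℂ] H) : Prop where
  mem : ∀ w, J w ∈ A.domain
  add_smul : ∀ w, J w + (l : ℂ) • opApply A (J w) = w

lemma exists_isResolvent (hA : IsSelfAdjoint A) (hA0 : IsNonnegOp A) {l : ℝ} (hl : 0 < l) :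
    ∃ J, IsResolvent A l J := by
  choose g hg hg' using exists_add_smul_opApply_eq hA hA0 hl
  let f : H →ₗ[ℂ] H :=
    { toFun := g
      map_add' := fun x y => by
        refine eq_of_add_smul_opApply_eq hA0 hl (hg _) (A.domain.add_mem (hg _) (hg _)) ?_
        rw [hg', opApply_add (hg _) (hg _), smul_add, add_add_add_comm, hg', hg']
      map_smul' := fun c x => by
        refine eq_of_add_smul_opApply_eq hA0 hl (hg _) (A.domain.smul_mem _ (hg _)) ?_
        rw [hg', RingHom.id_apply, opApply_smul _ (hg _), smul_comm, ← smul_add, hg'] }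
  refine ⟨f.mkContinuous 1 fun x => ?_, hg, hg'⟩
  rw [one_mul]
  exact (norm_le_norm_add_smul hl (hA0.re_inner_opApply (hg x))).trans_eq (by rw [hg'])

/-- The resolvent `(1 + l A)⁻¹` for `l > 0`. -/
def resolventOp (A : H →ₗ.[ℂ] H) (l : ℝ) : H →L[ℂ] H :=
  open Classical in if h : ∃ J, IsResolvent A l J then h.choose else 0

lemma isResolvent_resolventOp (hA : IsSelfAdjoint A) (hA0 : IsNonnegOp A) {l : ℝ} (hl : 0 < l) :
    IsResolvent A l (resolventOp A l) := by
  have h := exists_isResolvent hA hA0 hl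
  rw [resolventOp, dif_pos h]
  exact h.choose_spec

namespace IsResolvent

variable {l : ℝ} {J : H →L[ℂ] H}

lemma eq_of_add_smul (hJ : IsResolvent A l J) (hA0 : IsNonnegOp A) (hl : 0 < l) {x w : H}
    (hx : x ∈ A.domain) (h : x + (l : ℂ) • opApply A x = w) : J w = x :=
  eq_of_add_smul_opApply_eq hA0 hl (hJ.mem w) hx ((hJ.add_smul w).trans h.symm)

lemma norm_apply_le (hJ : IsResolvent A l J) (hA0 : IsNonnegOp A) (hl : 0 < l) (w : H) :
    ‖J w‖ ≤ ‖w‖ :=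
  (norm_le_norm_add_smul hl (hA0.re_inner_opApply (hJ.mem w))).trans_eq (by rw [hJ.add_smul])

lemma opApply_eq (hJ : IsResolvent A l J) (hl : 0 < l) (w : H) :
    opApply A (J w) = (l : ℂ)⁻¹ • (w - J w) := by
  have hl' : (l : ℂ) ≠ 0 := by exact_mod_cast hl.ne'
  have h : w - J w = (l : ℂ) • opApply A (J w) := sub_eq_of_eq_add' (hJ.add_smul w).symm
  rw [h, inv_smul_smul₀ hl']

lemma opApply_comm (hJ : IsResolvent A l J) (hA0 : IsNonnegOp A) (hl : 0 < l) {x : H}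
    (hx : x ∈ A.domain) : opApply A (J x) = J (opApply A x) := by
  have h : J (x + (l : ℂ) • opApply A x) = x := hJ.eq_of_add_smul hA0 hl hx rfl
  have hl' : (l : ℂ) ≠ 0 := by exact_mod_cast hl.ne'
  rw [hJ.opApply_eq hl]
  have h3 : x - J x = (l : ℂ) • J (opApply A x) := by
    rw [map_add, map_smul] at h
    nth_rw 1 [← h]
    abel
  rw [h3, inv_smul_smul₀ hl']

lemma inner_left (hJ : IsResolvent A l J) (hA : IsSelfAdjoint A) (x y : H) :
    inner ℂ (J x) y = inner ℂ x (J y) := by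
  nth_rw 1 [← hJ.add_smul y]
  nth_rw 2 [← hJ.add_smul x]
  rw [inner_add_left, inner_add_right, inner_smul_left, inner_smul_right, Complex.conj_ofReal,
    inner_opApply_left hA (hJ.mem x) (hJ.mem y)]

end IsResolvent

/-- The bounded Yosida approximation `A (1 + l A)⁻¹`. -/
def yosidaOp (A : H →ₗ.[ℂ] H) (l : ℝ) : H →L[ℂ] H :=
  (l : ℂ)⁻¹ • (ContinuousLinearMap.id ℂ H - resolventOp A l)

lemma opApply_resolventOp (hA : IsSelfAdjoint A) (hA0 : IsNonnegOp A) {l : ℝ} (hl : 0 < l)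
    (w : H) : opApply A (resolventOp A l w) = yosidaOp A l w :=
  (isResolvent_resolventOp hA hA0 hl).opApply_eq hl w

lemma tendsto_resolventOp (hA : IsSelfAdjoint A) (hA0 : IsNonnegOp A) (x : H) :
    Tendsto (fun l => resolventOp A l x) (𝓝[>] 0) (𝓝 x) := by
  rw [Metric.tendsto_nhds]
  intro ε hε
  obtain ⟨y, hyx, hy⟩ := Metric.dense_iff.1 hA.dense_domain x (ε / 3) (by positivity)
  rw [Metric.mem_ball, dist_eq_norm] at hyx
  have hlim : Tendsto (fun l : ℝ => l * ‖opApply A y‖) (𝓝[>] 0) (𝓝 0) := by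
    have : Tendsto (fun l : ℝ => l * ‖opApply A y‖) (𝓝 0) (𝓝 (0 * ‖opApply A y‖)) :=
      tendsto_id.mul_const _
    rw [zero_mul] at this
    exact this.mono_left nhdsWithin_le_nhds
  filter_upwards [hlim.eventually_lt_const (show 0 < ε / 3 by positivity), self_mem_nhdsWithin]
    with l hl1 hl
  rw [mem_Ioi] at hl
  have hJ := isResolvent_resolventOp hA hA0 hl
  set J := resolventOp A l
  have h1 : y - J y = (l : ℂ) • J (opApply A y) := by
    rw [← hJ.opApply_comm hA0 hl hy]
    exact sub_eq_of_eq_add' (hJ.add_smul y).symm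
  have h2 : ‖y - J y‖ ≤ l * ‖opApply A y‖ := by
    rw [h1, norm_smul, Complex.norm_real, Real.norm_of_nonneg hl.le]
    exact mul_le_mul_of_nonneg_left (hJ.norm_apply_le hA0 hl _) hl.le
  have h3 : ‖J (x - y)‖ ≤ ‖x - y‖ := hJ.norm_apply_le hA0 hl _
  have h4 : J x - x = J (x - y) - (y - J y) + (y - x) := by
    rw [map_sub]; abel
  rw [norm_sub_rev] at h3
  rw [dist_eq_norm, h4]
  calc _ ≤ ‖J (x - y)‖ + ‖y - J y‖ + ‖y - x‖ :=
        (norm_add_le _ _).trans (add_le_add_left (norm_sub_le _ _) _)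
    _ < ε := by linarith

/-- Boundedness of `A (1 + l A)⁻¹ x` along a sequence `l → 0` forces `x ∈ D(A)`. -/
lemma mem_domain_of_frequently_norm_yosidaOp_le (hA : IsSelfAdjoint A) (hA0 : IsNonnegOp A)
    {l : ℕ → ℝ} (hl : ∀ n, 0 < l n) (hl0 : Tendsto l atTop (𝓝 0)) {x : H} {M : ℝ}
    (hM : ∃ᶠ n in atTop, ‖yosidaOp A (l n) x‖ ≤ M) : x ∈ A.domain := by
  have hl0' : Tendsto l atTop (𝓝[>] 0) :=
    tendsto_nhdsWithin_iff.2 ⟨hl0, Eventually.of_forall hl⟩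
  have hbound : ∀ a ∈ A.domain, ‖(inner ℂ (opApply A a) x : ℂ)‖ ≤ M * ‖a‖ := by
    intro a ha
    have h1 : Tendsto (fun n => ‖(inner ℂ (opApply A a) (resolventOp A (l n) x) : ℂ)‖) atTop
        (𝓝 ‖(inner ℂ (opApply A a) x : ℂ)‖) :=
      (tendsto_const_nhds.inner ((tendsto_resolventOp hA hA0 x).comp hl0')).norm
    refine le_of_tendsto_of_frequently h1 (hM.mono fun n hn => ?_)
    have hJ := isResolvent_resolventOp hA hA0 (hl n)
    rw [inner_opApply_left hA ha (hJ.mem _), opApply_resolventOp hA hA0 (hl n)]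
    refine (norm_inner_le_norm _ _).trans ?_
    rw [mul_comm]
    exact mul_le_mul_of_nonneg_right hn (norm_nonneg _)
  rw [← LinearPMap.isSelfAdjoint_def.1 hA, LinearPMap.mem_adjoint_domain_iff]
  refine AddMonoidHomClass.continuous_of_bound _ M fun a => ?_
  have := hbound a a.2
  rw [opApply_of_mem a.2] at this
  rw [LinearMap.comp_apply, innerₛₗ_apply_apply, ← norm_inner_symm]
  exact this

end

/-! ### Square roots -/

section

variable [CompleteSpace H]

/-- The operator with graph `{(C u, D u)}`, for `C` injective. -/
def quotientOp (C D : H →L[ℂ] H) : H →ₗ.[ℂ] H :=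
  (LinearMap.range (C.prod D : H →ₗ[ℂ] H × H)).toLinearPMap

lemma mem_graph_quotientOp {C D : H →L[ℂ] H} (hC : ∀ u, C u = 0 → u = 0) {x y : H} :
    (x, y) ∈ (quotientOp C D).graph ↔ ∃ u, C u = x ∧ D u = y := by
  rw [quotientOp, Submodule.toLinearPMap_graph_eq]
  · simp
  · rintro ⟨a, b⟩ ⟨u, hu⟩ h
    simp only [ContinuousLinearMap.coe_coe, ContinuousLinearMap.prod_apply, Prod.mk.injEq] at hu h
    rw [← hu.2, hC u (hu.1.trans h), map_zero]

lemma IsResolvent.isPositive {A : H →ₗ.[ℂ] H} {l : ℝ} {J : H →L[ℂ] H} (hJ : IsResolvent A l J)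
    (hA : IsSelfAdjoint A) (hA0 : IsNonnegOp A) (hl : 0 < l) : J.IsPositive := by
  rw [ContinuousLinearMap.isPositive_def]
  refine ⟨hJ.inner_left hA, fun x => ?_⟩
  rw [ContinuousLinearMap.reApplyInnerSelf_apply]
  nth_rw 2 [← hJ.add_smul x]
  rw [inner_add_right, inner_smul_right, map_add]
  refine add_nonneg inner_self_nonneg ?_
  have h := hA0.re_inner_opApply (hJ.mem x)
  replace h := h.trans_eq (inner_re_symm (𝕜 := ℂ) _ _)
  change 0 ≤ ((l : ℂ) * _).re
  rw [Complex.re_ofReal_mul]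
  exact mul_nonneg hl.le h

lemma IsResolvent.isPositive_one_sub {A : H →ₗ.[ℂ] H} {l : ℝ} {J : H →L[ℂ] H}
    (hJ : IsResolvent A l J) (hA : IsSelfAdjoint A) (hA0 : IsNonnegOp A) (hl : 0 < l) :
    (1 - J).IsPositive := by
  rw [ContinuousLinearMap.isPositive_def]
  refine ⟨fun x y => ?_, fun x => ?_⟩
  · have := hJ.inner_left hA x y
    simp [inner_sub_left, inner_sub_right, this]
  · rw [ContinuousLinearMap.reApplyInnerSelf_apply]
    have h1 : (RCLike.re (inner ℂ (J x) x) : ℝ) ≤ ‖x‖ ^ 2 := by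
      refine (re_inner_le_norm _ _).trans ?_
      nlinarith [hJ.norm_apply_le hA0 hl x, norm_nonneg x]
    have h2 : (RCLike.re (inner ℂ x x) : ℝ) = ‖x‖ ^ 2 := inner_self_eq_norm_sq (𝕜 := ℂ) x
    have h3 : (1 - J) x = x - J x := rfl
    rw [h3, inner_sub_left, map_sub, h2]
    linarith

lemma isNonnegSqrt_quotientOp {A : H →ₗ.[ℂ] H} (hA : IsSelfAdjoint A) (hA0 : IsNonnegOp A)
    {J C D : H →L[ℂ] H} (hJ : IsResolvent A 1 J) (hCC : C * C = J) (hDD : D * D = 1 - J)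
    (hCD : Commute C D) (hC : ∀ x y, inner ℂ (C x) y = inner ℂ x (C y))
    (hD : ∀ x y, inner ℂ (D x) y = inner ℂ x (D y))
    (hpos : ∀ x, 0 ≤ (inner ℂ (D x) (C x)).re) : IsNonnegSqrt A (quotientOp C D) := by
  have hCC' : ∀ u, C (C u) = J u := fun u => by rw [← hCC]; rfl
  have hDD' : ∀ u, D (D u) = u - J u := fun u => by
    have : (D * D) u = (1 - J) u := by rw [hDD]
    exact this
  have hCD' : ∀ u, C (D u) = D (C u) := fun u => by
    have : (C * D) u = (D * C) u := by rw [hCD.eq]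
    exact this
  have hJinj : ∀ u, J u = 0 → u = 0 := by
    intro u hu
    have := hJ.add_smul u
    rw [hu, opApply_zero, smul_zero, add_zero] at this
    exact this.symm
  have hCinj : ∀ u, C u = 0 → u = 0 := fun u hu => hJinj u (by rw [← hCC', hu, map_zero])
  have hgraph : ∀ x y, (x, y) ∈ (quotientOp C D).graph ↔ ∃ u, C u = x ∧ D u = y :=
    fun x y => mem_graph_quotientOp hCinj
  have hdense : Dense ((quotientOp C D).domain : Set H) := by
    refine hA.dense_domain.mono fun x hx => ?_
    have h : J (x + ((1 : ℝ) : ℂ) • opApply A x) = x := hJ.eq_of_add_smul hA0 one_pos hx rfl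
    refine LinearPMap.mem_domain_iff.2 ⟨_, (hgraph _ _).2 ⟨C (x + ((1 : ℝ) : ℂ) • opApply A x),
      ?_, rfl⟩⟩
    rw [hCC', h]
  refine ⟨?_, ?_, ?_⟩
  · rw [LinearPMap.isSelfAdjoint_def]
    apply LinearPMap.eq_of_eq_graph
    rw [LinearPMap.adjoint_graph_eq_graph_adjoint hdense]
    ext ⟨y, z⟩
    rw [Submodule.mem_adjoint_iff, hgraph]
    constructor
    · intro h
      have h1 : D y = C z := by
        refine ext_inner_left ℂ fun u => ?_
        have := h _ _ ((hgraph _ _).2 ⟨u, rfl, rfl⟩)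
        rw [sub_eq_zero, hD, hC] at this
        exact this
      refine ⟨C y + D z, ?_, ?_⟩
      · rw [map_add, hCC', hCD', ← h1, hDD']
        abel
      · rw [map_add, hDD', ← hCD', h1, hCC']
        abel
    · rintro ⟨u, rfl, rfl⟩ a b hab
      obtain ⟨v, rfl, rfl⟩ := (hgraph _ _).1 hab
      rw [sub_eq_zero, hD, hC, hCD']
  · rintro ⟨x, hx⟩
    obtain ⟨u, rfl, hu⟩ := (hgraph _ _).1 (opApply_mem_graph hx)
    rw [← opApply_of_mem hx, ← hu]
    exact hpos u
  · intro x z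
    rw [mem_graph_iff_opApply]
    constructor
    · rintro ⟨hx, rfl⟩
      have h : J (x + ((1 : ℝ) : ℂ) • opApply A x) = x := hJ.eq_of_add_smul hA0 one_pos hx rfl
      rw [Complex.ofReal_one, one_smul] at h
      set w := x + opApply A x with hw
      refine ⟨D (C w), (hgraph _ _).2 ⟨C w, by rw [hCC', h], rfl⟩,
        (hgraph _ _).2 ⟨D w, hCD' w, ?_⟩⟩
      rw [hDD', h, hw]
      abel
    · rintro ⟨y, h1, h2⟩
      obtain ⟨u, rfl, rfl⟩ := (hgraph _ _).1 h1
      obtain ⟨v, hv, rfl⟩ := (hgraph _ _).1 h2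
      have hw : C (C u + D v) = u := by
        rw [map_add, hCC', hCD', hv, hDD']
        abel
      have hJw : J (C u + D v) = C u := by rw [← hCC', hw]
      refine ⟨hJw ▸ hJ.mem _, ?_⟩
      have := hJ.add_smul (C u + D v)
      rw [hJw, Complex.ofReal_one, one_smul] at this
      exact add_left_cancel this

/-- Every nonnegative selfadjoint operator has a nonnegative selfadjoint square root. -/
lemma exists_isNonnegSqrt {A : H →ₗ.[ℂ] H} (hA : IsSelfAdjoint A) (hA0 : IsNonnegOp A) :
    ∃ S, IsNonnegSqrt A S := by
  obtain ⟨J, hJ⟩ := exists_isResolvent hA hA0 one_pos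
  have h0 : 0 ≤ J := (ContinuousLinearMap.nonneg_iff_isPositive J).2
    (hJ.isPositive hA hA0 one_pos)
  have h1 : 0 ≤ 1 - J := (ContinuousLinearMap.nonneg_iff_isPositive _).2
    (hJ.isPositive_one_sub hA hA0 one_pos)
  have hcomm : Commute (CFC.sqrt J) (CFC.sqrt (1 - J)) := by
    have hc : Commute J (1 - J) := (Commute.one_right J).sub_right (Commute.refl J)
    exact ((hc.cfcₙ_nnreal NNReal.sqrt).symm.cfcₙ_nnreal NNReal.sqrt).symm
  have hC := (ContinuousLinearMap.nonneg_iff_isPositive _).1 (CFC.sqrt_nonneg J)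
  have hD := (ContinuousLinearMap.nonneg_iff_isPositive _).1 (CFC.sqrt_nonneg (1 - J))
  have hDC := (ContinuousLinearMap.nonneg_iff_isPositive _).1
    (hcomm.mul_nonneg (CFC.sqrt_nonneg J) (CFC.sqrt_nonneg (1 - J)))
  refine ⟨_, isNonnegSqrt_quotientOp hA hA0 hJ (CFC.sqrt_mul_sqrt_self J h0)
    (CFC.sqrt_mul_sqrt_self _ h1) hcomm hC.inner_left_eq_inner_right
    hD.inner_left_eq_inner_right fun x => ?_⟩
  rw [← hC.inner_left_eq_inner_right]
  exact hDC.re_inner_nonneg_left x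

lemma isNonnegSqrt_opSqrt {A : H →ₗ.[ℂ] H} (hA : IsSelfAdjoint A) (hA0 : IsNonnegOp A) :
    IsNonnegSqrt A (opSqrt A) := by
  have h := exists_isNonnegSqrt hA hA0
  rw [opSqrt, dif_pos h]
  exact h.choose_spec

lemma IsNonnegSqrt.mem_domain {A S : H →ₗ.[ℂ] H} (hS : IsNonnegSqrt A S) {x : H}
    (hx : x ∈ A.domain) :
    x ∈ S.domain ∧ opApply S x ∈ S.domain ∧ opApply S (opApply S x) = opApply A x := by
  obtain ⟨y, h1, h2⟩ := (hS.sq _ _).1 (opApply_mem_graph hx)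
  obtain ⟨h3, rfl⟩ := mem_graph_iff_opApply.1 h1
  exact ⟨h3, mem_graph_iff_opApply.1 h2⟩

lemma IsNonnegSqrt.re_inner_opApply {A S : H →ₗ.[ℂ] H} (hS : IsNonnegSqrt A S) {x : H}
    (hx : x ∈ A.domain) : (inner ℂ (opApply A x) x).re = ‖opApply S x‖ ^ 2 := by
  obtain ⟨h1, h2, h3⟩ := hS.mem_domain hx
  rw [← h3, inner_opApply_left hS.selfAdjoint h2 h1]
  exact inner_self_eq_norm_sq (𝕜 := ℂ) _

lemma IsNonnegSqrt.resolventOp_le {A S : H →ₗ.[ℂ] H} (hS : IsNonnegSqrt A S)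
    (hA : IsSelfAdjoint A) (hA0 : IsNonnegOp A) {l : ℝ} (hl : 0 < l) {x : H}
    (hx : x ∈ S.domain) :
    ‖opApply S (resolventOp A l x)‖ ≤ ‖opApply S x‖ ∧
      (inner ℂ (yosidaOp A l x) x).re ≤ ‖opApply S x‖ ^ 2 := by
  have hJ := isResolvent_resolventOp hA hA0 hl
  obtain ⟨h1, h2, h3⟩ := hS.mem_domain (hJ.mem x)
  have h4 : (inner ℂ (yosidaOp A l x) x).re ≤
      ‖opApply S (resolventOp A l x)‖ * ‖opApply S x‖ := by
    rw [← opApply_resolventOp hA hA0 hl, ← h3, inner_opApply_left hS.selfAdjoint h2 hx]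
    exact re_inner_le_norm (𝕜 := ℂ) _ _
  have h5 : ‖opApply S (resolventOp A l x)‖ ^ 2 ≤ (inner ℂ (yosidaOp A l x) x).re := by
    have h6 : (inner ℂ (yosidaOp A l x) x : ℂ) = inner ℂ (opApply A (resolventOp A l x))
        (resolventOp A l x + (l : ℂ) • opApply A (resolventOp A l x)) := by
      rw [hJ.add_smul, opApply_resolventOp hA hA0 hl]
    rw [h6, inner_add_right, Complex.add_re, hS.re_inner_opApply (hJ.mem x), inner_smul_right,
      Complex.re_ofReal_mul]
    have h8 : 0 ≤ (inner ℂ (opApply A (resolventOp A l x)) (opApply A (resolventOp A l x))).re :=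
      inner_self_nonneg (𝕜 := ℂ)
    have := mul_nonneg hl.le h8
    linarith
  have h7 : ‖opApply S (resolventOp A l x)‖ ≤ ‖opApply S x‖ := by
    by_contra! h
    nlinarith [norm_nonneg (opApply S x)]
  refine ⟨h7, h4.trans ?_⟩
  rw [pow_two]
  exact mul_le_mul_of_nonneg_right h7 (norm_nonneg _)

end

/-! ### The energy identity -/

lemma AbsolutelyContinuousOnInterval.of_dist_le {X Y : Type*} [PseudoMetricSpace X]
    [PseudoMetricSpace Y] {f : ℝ → X} {p : ℝ → Y} {a b M : ℝ}
    (hp : AbsolutelyContinuousOnInterval p a b)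
    (h : ∀ x ∈ uIcc a b, ∀ y ∈ uIcc a b, dist (f x) (f y) ≤ M * dist (p x) (p y)) :
    AbsolutelyContinuousOnInterval f a b := by
  have h0 := Filter.Tendsto.const_mul M hp
  rw [mul_zero] at h0
  refine squeeze_zero' (Eventually.of_forall fun E => Finset.sum_nonneg fun _ _ => dist_nonneg)
    ?_ h0
  refine eventually_inf_principal.2 (Eventually.of_forall fun E hE => ?_)
  rw [Finset.mul_sum]
  exact Finset.sum_le_sum fun i hi => h _ (hE.1 i hi).1 _ (hE.1 i hi).2

lemma re_inner_comm (x y : H) : (inner ℂ x y : ℂ).re = (inner ℂ y x : ℂ).re :=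
  inner_re_symm (𝕜 := ℂ) x y

lemma integrable_norm_mul_norm {α : Type*} {m : MeasurableSpace α} {μ : Measure α} {X : Type*}
    [NormedAddCommGroup X] {f g : α → X}
    (hf : MemLp f 2 μ) (hg : MemLp g 2 μ) : Integrable (fun t => ‖f t‖ * ‖g t‖) μ :=
  MemLp.integrable_mul hf.norm hg.norm

lemma memLp_two_intervalIntegrable {X : Type*} [NormedAddCommGroup X]
    {f : ℝ → X} {a b : ℝ} (hab : a ≤ b)
    (hf : MemLp f 2 (volume.restrict (Ioc a b))) : IntervalIntegrable f volume a b :=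
  (intervalIntegrable_iff_integrableOn_Ioc_of_le hab).2 (hf.integrable one_le_two)

lemma lintegral_enorm_sq_eq_ofReal {X : Type*} [NormedAddCommGroup X] {α : Type*}
    {m : MeasurableSpace α} {μ : Measure α} {f : α → X}
    (hf : MemLp f 2 μ) : ∫⁻ t, ‖f t‖ₑ ^ 2 ∂μ = ENNReal.ofReal (∫ t, ‖f t‖ ^ 2 ∂μ) := by
  rw [ofReal_integral_eq_lintegral_ofReal (hf.integrable_norm_pow two_ne_zero)
    (Eventually.of_forall fun t => by positivity)]
  refine lintegral_congr fun t => ?_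
  rw [ENNReal.ofReal_pow (norm_nonneg _), ofReal_norm]

lemma abs_re_inner_le_norm (x y : H) : |(inner ℂ x y : ℂ).re| ≤ ‖x‖ * ‖y‖ :=
  (Complex.abs_re_le_norm _).trans (norm_inner_le_norm _ _)

section

variable [CompleteSpace H]

/-- `d/dt ⟨L W, W⟩ = 2 Re ⟨W', L W⟩`, integrated, for a bounded symmetric operator `L`. -/
lemma integral_two_mul_re_inner_eq {L : H →L[ℂ] H}
    (hL : ∀ x y, inner ℂ (L x) y = inner ℂ x (L y)) {b : ℝ} (hb : 0 ≤ b) {W ψ : ℝ → H} {W₀ : H}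
    (hψ : IntervalIntegrable ψ volume 0 b)
    (hW : ∀ t ∈ Icc 0 b, W t = W₀ + ∫ τ in (0 : ℝ)..t, ψ τ) :
    ∫ t in (0 : ℝ)..b, 2 * (inner ℂ (ψ t) (L (W t))).re =
      (inner ℂ (L (W b)) (W b)).re - (inner ℂ (L W₀) W₀).re := by
  set V : ℝ → H := fun t => W₀ + ∫ τ in (0 : ℝ)..t, ψ τ with hV
  have hWV : ∀ t ∈ Icc 0 b, W t = V t := hW
  have hV0 : V 0 = W₀ := by simp [hV]
  have hsub : ∀ x ∈ uIcc 0 b, ∀ y ∈ uIcc 0 b, IntervalIntegrable ψ volume x y :=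
    fun x hx y hy => hψ.mono_set (uIcc_subset_uIcc hx hy)
  have h0 : (0 : ℝ) ∈ uIcc 0 b := left_mem_uIcc
  have hVc : ContinuousOn V (uIcc 0 b) :=
    continuousOn_const.add (intervalIntegral.continuousOn_primitive_interval' hψ h0)
  obtain ⟨M, hM⟩ := isCompact_uIcc.exists_bound_of_continuousOn hVc
  set q : ℝ → ℝ := fun t => (inner ℂ (L (V t)) (V t)).re with hq
  set p : ℝ → ℝ := fun t => ∫ τ in (0 : ℝ)..t, ‖ψ τ‖ with hp
  have hpac : AbsolutelyContinuousOnInterval p 0 b :=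
    hψ.norm.absolutelyContinuousOnInterval_intervalIntegral h0
  have hVsub : ∀ x ∈ uIcc 0 b, ∀ y ∈ uIcc 0 b, ‖V x - V y‖ ≤ dist (p x) (p y) := by
    intro x hx y hy
    have e1 : V x - V y = ∫ τ in y..x, ψ τ := by
      simp only [hV, add_sub_add_left_eq_sub]
      exact intervalIntegral.integral_interval_sub_left (hsub _ h0 _ hx) (hsub _ h0 _ hy)
    have e2 : p x - p y = ∫ τ in y..x, ‖ψ τ‖ :=
      intervalIntegral.integral_interval_sub_left (hsub _ h0 _ hx).norm (hsub _ h0 _ hy).norm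
    rw [e1, Real.dist_eq, e2]
    exact intervalIntegral.norm_integral_le_abs_integral_norm
  have hqac : AbsolutelyContinuousOnInterval q 0 b := by
    refine hpac.of_dist_le (M := 2 * ‖L‖ * M) fun x hx y hy => ?_
    have e : q x - q y = (inner ℂ (L (V x - V y)) (V x)).re
        + (inner ℂ (L (V y)) (V x - V y)).re := by
      simp only [hq, map_sub, inner_sub_left, inner_sub_right, Complex.sub_re]
      ring
    have hM0 : 0 ≤ M := (norm_nonneg _).trans (hM x hx)
    have b1 : |(inner ℂ (L (V x - V y)) (V x)).re| ≤ ‖L‖ * M * dist (p x) (p y) := by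
      calc _ ≤ ‖L (V x - V y)‖ * ‖V x‖ := abs_re_inner_le_norm _ _
        _ ≤ (‖L‖ * dist (p x) (p y)) * M := by
          gcongr
          · exact (L.le_opNorm _).trans (by gcongr; exact hVsub x hx y hy)
          · exact hM x hx
        _ = _ := by ring
    have b2 : |(inner ℂ (L (V y)) (V x - V y)).re| ≤ ‖L‖ * M * dist (p x) (p y) := by
      calc _ ≤ ‖L (V y)‖ * ‖V x - V y‖ := abs_re_inner_le_norm _ _
        _ ≤ (‖L‖ * M) * dist (p x) (p y) := by
          gcongr
          · exact (L.le_opNorm _).trans (by gcongr; exact hM y hy)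
          · exact hVsub x hx y hy
    rw [Real.dist_eq, e]
    refine (abs_add_le _ _).trans ?_
    linarith
  have hderiv : ∀ᵐ t, t ∈ uIcc 0 b → HasDerivAt q (2 * (inner ℂ (ψ t) (L (V t))).re) t := by
    filter_upwards [hψ.ae_hasDerivAt_integral] with t ht htm
    have d1 : HasDerivAt V (ψ t) t := (ht htm 0 h0).const_add W₀
    have d2 : HasDerivAt (fun s => L (V s)) (L (ψ t)) t :=
      (L.restrictScalars ℝ).hasFDerivAt.comp_hasDerivAt t d1
    have d3 := Complex.reCLM.hasFDerivAt.comp_hasDerivAt t (d2.inner ℂ d1)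
    convert! d3 using 1
    rw [Complex.reCLM_apply, Complex.add_re, re_inner_comm (L (V t)), hL]
    ring
  have hmain := hqac.integral_deriv_eq_sub
  rw [hWV b ⟨hb, le_rfl⟩, ← hV0]
  change _ = q b - q 0
  rw [← hmain]
  refine intervalIntegral.integral_congr_ae ?_
  filter_upwards [hderiv] with t ht htm
  rw [uIoc_of_le hb] at htm
  rw [(ht (by rw [uIcc_of_le hb]; exact Ioc_subset_Icc_self htm)).deriv,
    hWV t (Ioc_subset_Icc_self htm)]

lemma integrable_re_inner {α : Type*} {m : MeasurableSpace α} {μ : Measure α} {f g : α → H}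
    (hf : MemLp f 2 μ) (hg : MemLp g 2 μ) : Integrable (fun t => (inner ℂ (f t) (g t)).re) μ := by
  refine (integrable_norm_mul_norm hf hg).mono' ?_ (Eventually.of_forall fun t => ?_)
  · exact Complex.continuous_re.comp_aestronglyMeasurable (hf.1.inner hg.1)
  · exact abs_re_inner_le_norm _ _

/-- `∫ 2 Re ⟨W', A W⟩ ≥ - ‖A^{1/2} W₀‖²`. -/
lemma neg_norm_sq_le_integral_re_inner {A S : H →ₗ.[ℂ] H} (hA : IsSelfAdjoint A)
    (hA0 : IsNonnegOp A) (hS : IsNonnegSqrt A S) {b : ℝ} (hb : 0 ≤ b) {W ψ : ℝ → H} {W₀ : H}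
    (hW₀ : W₀ ∈ S.domain) (hψ : MemLp ψ 2 (volume.restrict (Ioc 0 b)))
    (hW : ∀ t ∈ Icc 0 b, W t = W₀ + ∫ τ in (0 : ℝ)..t, ψ τ)
    (hWA : ∀ᵐ t ∂(volume.restrict (Ioc 0 b)), W t ∈ A.domain)
    (hG : MemLp (fun t => opApply A (W t)) 2 (volume.restrict (Ioc 0 b))) :
    -‖opApply S W₀‖ ^ 2 ≤ ∫ t in (0 : ℝ)..b, 2 * (inner ℂ (ψ t) (opApply A (W t))).re := by
  have hl0 : Tendsto (fun n : ℕ => (1 / ((n : ℝ) + 1))) atTop (𝓝[>] 0) :=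
    tendsto_nhdsWithin_iff.2 ⟨tendsto_one_div_add_atTop_nhds_zero_nat,
      Eventually.of_forall fun n => mem_Ioi.2 (by positivity)⟩
  set l : ℕ → ℝ := fun n => 1 / ((n : ℝ) + 1) with hl
  have hlpos : ∀ n, 0 < l n := fun n => by simp only [hl]; positivity
  have hψi := memLp_two_intervalIntegrable hb hψ
  have key : ∀ n, -‖opApply S W₀‖ ^ 2 ≤
      ∫ t in (0 : ℝ)..b, 2 * (inner ℂ (ψ t) (resolventOp A (l n) (opApply A (W t)))).re := by
    intro n
    have hJ := isResolvent_resolventOp hA hA0 (hlpos n)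
    have hsymm : ∀ x y, inner ℂ (yosidaOp A (l n) x) y = inner ℂ x (yosidaOp A (l n) y) := by
      intro x y
      simp only [yosidaOp, _root_.smul_apply, _root_.sub_apply,
        ContinuousLinearMap.id_apply, inner_smul_left, inner_smul_right, inner_sub_left,
        inner_sub_right, hJ.inner_left hA x y, map_inv₀, Complex.conj_ofReal]
    have h1 := integral_two_mul_re_inner_eq hsymm hb hψi hW
    have h2 : ∫ t in (0 : ℝ)..b, 2 * (inner ℂ (ψ t) (resolventOp A (l n) (opApply A (W t)))).re =
        ∫ t in (0 : ℝ)..b, 2 * (inner ℂ (ψ t) (yosidaOp A (l n) (W t))).re := by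
      rw [intervalIntegral.integral_of_le hb, intervalIntegral.integral_of_le hb]
      refine integral_congr_ae ?_
      filter_upwards [hWA] with t ht
      rw [← hJ.opApply_comm hA0 (hlpos n) ht, opApply_resolventOp hA hA0 (hlpos n)]
    rw [h2, h1]
    have h3 := (hS.resolventOp_le hA hA0 (hlpos n) hW₀).2
    have h4 : 0 ≤ (inner ℂ (yosidaOp A (l n) (W b)) (W b)).re := by
      have h5 : inner ℂ (yosidaOp A (l n) (W b)) (W b) =
          inner ℂ (opApply A (resolventOp A (l n) (W b))) (resolventOp A (l n) (W b)
            + (l n : ℂ) • opApply A (resolventOp A (l n) (W b))) := by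
        rw [hJ.add_smul, opApply_resolventOp hA hA0 (hlpos n)]
      rw [h5, inner_add_right, Complex.add_re, inner_smul_right, Complex.re_ofReal_mul]
      exact add_nonneg (hA0.re_inner_opApply (hJ.mem _))
        (mul_nonneg (hlpos n).le (inner_self_nonneg (𝕜 := ℂ)))
    linarith
  refine ge_of_tendsto' (f := fun n => ∫ t in (0 : ℝ)..b,
    2 * (inner ℂ (ψ t) (resolventOp A (l n) (opApply A (W t)))).re) (x := atTop) ?_ key
  refine intervalIntegral.tendsto_integral_filter_of_dominated_convergence
    (fun t => 2 * (‖ψ t‖ * ‖opApply A (W t)‖)) ?_ ?_ ?_ ?_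
  · refine Eventually.of_forall fun n => ?_
    rw [uIoc_of_le hb]
    exact (Complex.continuous_re.comp_aestronglyMeasurable (hψ.1.inner
      ((resolventOp A (l n)).continuous.comp_aestronglyMeasurable hG.1))).const_mul 2
  · refine Eventually.of_forall fun n => Eventually.of_forall fun t _ => ?_
    rw [norm_mul, Real.norm_ofNat]
    gcongr
    refine (abs_re_inner_le_norm _ _).trans ?_
    gcongr
    exact (isResolvent_resolventOp hA hA0 (hlpos n)).norm_apply_le hA0 (hlpos n) _
  · rw [intervalIntegrable_iff_integrableOn_Ioc_of_le hb]
    exact (integrable_norm_mul_norm hψ hG).const_mul 2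
  · refine Eventually.of_forall fun t _ => ?_
    exact ((Complex.continuous_re.tendsto _).comp (tendsto_const_nhds.inner
      ((tendsto_resolventOp hA hA0 _).comp hl0))).const_mul 2

/-- The energy estimate: `‖W'‖² + ‖A W‖² ≤ ‖W' + A W‖² + ‖A^{1/2} W₀‖²` in `L²(0, b)`. -/
lemma lintegral_energy_le {A S : H →ₗ.[ℂ] H} (hA : IsSelfAdjoint A)
    (hA0 : IsNonnegOp A) (hS : IsNonnegSqrt A S) {b : ℝ} (hb : 0 ≤ b) {W ψ : ℝ → H} {W₀ : H}
    (hW₀ : W₀ ∈ S.domain) (hψ : MemLp ψ 2 (volume.restrict (Ioc 0 b)))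
    (hW : ∀ t ∈ Icc 0 b, W t = W₀ + ∫ τ in (0 : ℝ)..t, ψ τ)
    (hWA : ∀ᵐ t ∂(volume.restrict (Ioc 0 b)), W t ∈ A.domain)
    (hG : MemLp (fun t => opApply A (W t)) 2 (volume.restrict (Ioc 0 b))) :
    (∫⁻ t in Ioc 0 b, ‖ψ t‖ₑ ^ 2) + ∫⁻ t in Ioc 0 b, ‖opApply A (W t)‖ₑ ^ 2 ≤
      (∫⁻ t in Ioc 0 b, ‖ψ t + opApply A (W t)‖ₑ ^ 2) + ‖opApply S W₀‖ₑ ^ 2 := by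
  have h := neg_norm_sq_le_integral_re_inner hA hA0 hS hb hW₀ hψ hW hWA hG
  have hsum := hψ.add hG
  rw [lintegral_enorm_sq_eq_ofReal hψ, lintegral_enorm_sq_eq_ofReal hG,
    ← ofReal_norm, ← ENNReal.ofReal_pow (norm_nonneg _)]
  have e := lintegral_enorm_sq_eq_ofReal hsum
  simp only [Pi.add_apply] at e
  rw [e, ← ENNReal.ofReal_add (by positivity) (by positivity),
    ← ENNReal.ofReal_add (by positivity) (by positivity)]
  refine ENNReal.ofReal_le_ofReal ?_
  have i1 := hψ.integrable_norm_pow two_ne_zero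
  have i2 := hG.integrable_norm_pow two_ne_zero
  have i3 := (integrable_re_inner hψ hG).const_mul 2
  have e2 : ∫ t in Ioc 0 b, ‖ψ t + opApply A (W t)‖ ^ 2 = (∫ t in Ioc 0 b, ‖ψ t‖ ^ 2)
      + (∫ t in Ioc 0 b, 2 * (inner ℂ (ψ t) (opApply A (W t))).re)
      + ∫ t in Ioc 0 b, ‖opApply A (W t)‖ ^ 2 := by
    rw [← integral_add i1 i3, ← integral_add (by exact i1.add i3) i2]
    refine integral_congr_ae (Eventually.of_forall fun t => ?_)
    exact norm_add_sq (𝕜 := ℂ) _ _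
  rw [intervalIntegral.integral_of_le hb] at h
  rw [e2]
  linarith

end

/-! ### Functions of time -/

lemma timeInterval_mono_right {T : EReal} {s t : ℝ} (ht : t ∈ timeInterval T) (hs : 0 < s)
    (hst : s ≤ t) : s ∈ timeInterval T :=
  ⟨hs, (EReal.coe_le_coe_iff.2 hst).trans_lt ht.2⟩

lemma Ioc_subset_timeInterval {T : EReal} {t : ℝ} (ht : t ∈ timeInterval T) :
    Ioc 0 t ⊆ timeInterval T := fun _ hs => timeInterval_mono_right ht hs.1 hs.2

lemma uIcc_subset_timeInterval {T : EReal} {s t : ℝ} (hs : s ∈ timeInterval T)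
    (ht : t ∈ timeInterval T) : uIcc s t ⊆ timeInterval T := by
  rcases le_total s t with h | h
  · rw [uIcc_of_le h]
    exact fun r hr => timeInterval_mono_right ht (hs.1.trans_le hr.1) hr.2
  · rw [uIcc_of_ge h]
    exact fun r hr => timeInterval_mono_right hs (ht.1.trans_le hr.1) hr.2

lemma isOpen_timeInterval (T : EReal) : IsOpen (timeInterval T) :=
  isOpen_Ioi.inter (isOpen_Iio.preimage continuous_coe_real_ereal)

lemma measurableSet_timeInterval (T : EReal) : MeasurableSet (timeInterval T) :=
  (isOpen_timeInterval T).measurableSet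

lemma timeInterval_subset {S T : EReal} (h : S ≤ T) : timeInterval S ⊆ timeInterval T :=
  fun _ ht => ⟨ht.1, ht.2.trans_le h⟩

lemma exists_gt_mem_timeInterval {T : EReal} {t : ℝ} (ht : t ∈ timeInterval T) :
    ∃ q : ℚ, t < q ∧ (q : ℝ) ∈ timeInterval T := by
  obtain ⟨q, h1, h2⟩ := EReal.lt_iff_exists_rat_btwn.1 ht.2
  have h1' : t < q := EReal.coe_lt_coe_iff.1 h1
  exact ⟨q, h1', ht.1.trans h1', h2⟩

lemma timeInterval_eq_iUnion (T : EReal) :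
    timeInterval T = ⋃ q : {q : ℚ // (q : ℝ) ∈ timeInterval T}, Ioc 0 ((q : ℚ) : ℝ) := by
  refine Subset.antisymm (fun t ht => ?_) (iUnion_subset fun q => Ioc_subset_timeInterval q.2)
  obtain ⟨q, h1, h2⟩ := exists_gt_mem_timeInterval ht
  exact mem_iUnion.2 ⟨⟨q, h2⟩, ht.1, h1.le⟩

lemma lintegral_timeMeasure_le {T : EReal} {f : ℝ → ENNReal} {c : ENNReal}
    (h : ∀ b ∈ timeInterval T, ∫⁻ t in Ioc 0 b, f t ≤ c) : ∫⁻ t, f t ∂(timeMeasure T) ≤ c := by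
  rw [timeMeasure, timeInterval_eq_iUnion, setLIntegral_iUnion_of_directed]
  · exact iSup_le fun q => h _ q.2
  · refine Monotone.directed_le fun p q hpq => Ioc_subset_Ioc_right ?_
    exact_mod_cast hpq

lemma restrict_Ioc_le_timeMeasure {T : EReal} {t : ℝ} (ht : t ∈ timeInterval T) :
    volume.restrict (Ioc 0 t) ≤ timeMeasure T :=
  Measure.restrict_mono (Ioc_subset_timeInterval ht) le_rfl

lemma ae_timeMeasure_of_forall_Ioo {T : EReal} {p : ℝ → Prop}
    (h : ∀ a ∈ timeInterval T, ∀ b ∈ timeInterval T, a < b →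
      ∀ᵐ t, t ∈ Ioo a b → p t) : ∀ᵐ t ∂(timeMeasure T), p t := by
  rw [timeMeasure, ae_restrict_iff' (measurableSet_timeInterval T)]
  have hall : ∀ᵐ t, ∀ a : ℚ, ∀ b : ℚ, (a : ℝ) ∈ timeInterval T → (b : ℝ) ∈ timeInterval T →
      (a : ℝ) < b → t ∈ Ioo (a : ℝ) b → p t := by
    rw [ae_all_iff]
    intro a
    rw [ae_all_iff]
    intro b
    by_cases ha : (a : ℝ) ∈ timeInterval T
    · by_cases hb : (b : ℝ) ∈ timeInterval T
      · by_cases hab : (a : ℝ) < b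
        · filter_upwards [h _ ha _ hb hab] with t ht _ _ _ using ht
        · exact Eventually.of_forall fun t _ _ h => absurd h hab
      · exact Eventually.of_forall fun t _ h => absurd h hb
    · exact Eventually.of_forall fun t h => absurd h ha
  filter_upwards [hall] with t ht htT
  obtain ⟨b, hb1, hb2⟩ := exists_gt_mem_timeInterval htT
  obtain ⟨a, ha1, ha2⟩ := exists_rat_btwn htT.1
  exact ht a b (timeInterval_mono_right htT ha1 ha2.le) hb2 (ha2.trans hb1) ⟨ha2, hb1⟩

section

variable [CompleteSpace H] {T : EReal} {φ ψ ψ' : ℝ → H}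

lemma LocallyIntegrableOn.intervalIntegrable_timeInterval
    (h : LocallyIntegrableOn ψ (timeInterval T)) {s t : ℝ} (hs : s ∈ timeInterval T)
    (ht : t ∈ timeInterval T) : IntervalIntegrable ψ volume s t :=
  (h.integrableOn_compact_subset (uIcc_subset_timeInterval hs ht)
    isCompact_uIcc).intervalIntegrable

lemma IsTimeDeriv.ae_eq (h : IsTimeDeriv T φ ψ) (h' : IsTimeDeriv T φ ψ') :
    ψ =ᵐ[timeMeasure T] ψ' := by
  refine ae_timeMeasure_of_forall_Ioo fun a ha b hb hab => ?_
  have hi := LocallyIntegrableOn.intervalIntegrable_timeInterval h.1 ha hb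
  have hi' := LocallyIntegrableOn.intervalIntegrable_timeInterval h'.1 ha hb
  filter_upwards [hi.ae_hasDerivAt_integral, hi'.ae_hasDerivAt_integral] with t h1 h2 ht
  have htm : t ∈ uIcc a b := by
    rw [uIcc_of_le hab.le]
    exact Ioo_subset_Icc_self ht
  refine (h1 htm a left_mem_uIcc).unique ((h2 htm a left_mem_uIcc).congr_of_eventuallyEq ?_)
  filter_upwards [Ioo_mem_nhds ht.1 ht.2] with x hx
  have hx' : x ∈ timeInterval T := timeInterval_mono_right hb (ha.1.trans hx.1) hx.2.le
  rw [← h.2 a ha x hx', ← h'.2 a ha x hx']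

lemma timeDeriv_spec (h : ∃ ψ, IsTimeDeriv T φ ψ) : IsTimeDeriv T φ (timeDeriv T φ) := by
  rw [timeDeriv, dif_pos h]
  exact h.choose_spec

lemma IsTimeDeriv.timeDeriv_ae_eq (h : IsTimeDeriv T φ ψ) :
    timeDeriv T φ =ᵐ[timeMeasure T] ψ :=
  (timeDeriv_spec ⟨ψ, h⟩).ae_eq h

lemma MemLp.locallyIntegrableOn_timeInterval (h : MemLp ψ 2 (timeMeasure T)) :
    LocallyIntegrableOn ψ (timeInterval T) := by
  refine locallyIntegrableOn_of_locallyIntegrable_restrict ?_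
  exact MemLp.locallyIntegrable (μ := volume.restrict (timeInterval T)) h one_le_two

lemma MemLp.restrict_Ioc (h : MemLp ψ 2 (timeMeasure T)) {t : ℝ} (ht : t ∈ timeInterval T) :
    MemLp ψ 2 (volume.restrict (Ioc 0 t)) :=
  h.mono_measure (restrict_Ioc_le_timeMeasure ht)

lemma MemLp.intervalIntegrable_of_mem (h : MemLp ψ 2 (timeMeasure T)) {t : ℝ}
    (ht : t ∈ timeInterval T) : IntervalIntegrable ψ volume 0 t :=
  memLp_two_intervalIntegrable ht.1.le (MemLp.restrict_Ioc h ht)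

lemma IsTimeDeriv.sub {φ' : ℝ → H} (h : IsTimeDeriv T φ ψ) (h' : IsTimeDeriv T φ' ψ') :
    IsTimeDeriv T (fun t => φ t - φ' t) (fun t => ψ t - ψ' t) := by
  refine ⟨h.1.sub h'.1, fun s hs t ht => ?_⟩
  rw [intervalIntegral.integral_sub (LocallyIntegrableOn.intervalIntegrable_timeInterval h.1 hs ht)
    (LocallyIntegrableOn.intervalIntegrable_timeInterval h'.1 hs ht), ← h.2 s hs t ht,
    ← h'.2 s hs t ht]
  exact sub_sub_sub_comm _ _ _ _

lemma IsTimeDeriv.continuousOn (h : IsTimeDeriv T φ ψ) : ContinuousOn φ (timeInterval T) := by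
  intro t ht
  obtain ⟨b, htb, hb⟩ := exists_gt_mem_timeInterval ht
  have ha : t / 2 ∈ timeInterval T :=
    timeInterval_mono_right ht (half_pos ht.1) (half_le_self ht.1.le)
  have hab : t / 2 < (b : ℝ) := (half_lt_self ht.1).trans htb
  have hc := intervalIntegral.continuousOn_primitive_interval'
    (LocallyIntegrableOn.intervalIntegrable_timeInterval h.1 ha hb) left_mem_uIcc
  have hn : uIcc (t / 2) (b : ℝ) ∈ 𝓝 t := by
    rw [uIcc_of_le hab.le]
    exact Icc_mem_nhds (half_lt_self ht.1) htb
  refine ContinuousAt.continuousWithinAt ?_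
  refine ((continuousAt_const (y := φ (t / 2))).add (hc.continuousAt hn)).congr ?_
  filter_upwards [hn] with x hx
  change φ (t / 2) + (∫ τ in t / 2..x, ψ τ) = φ x
  rw [← h.2 _ ha x (uIcc_subset_timeInterval ha hb hx)]
  abel

/-- A function with square integrable derivative is the integral of it. -/
lemma IsTimeDeriv.eq_add_integral (h : IsTimeDeriv T φ ψ) (hψ : MemLp ψ 2 (timeMeasure T))
    {φ₀ : H} (h0 : Tendsto φ (𝓝[>] 0) (𝓝 φ₀)) {t : ℝ} (ht : t ∈ timeInterval T) :
    φ t = φ₀ + ∫ τ in (0 : ℝ)..t, ψ τ := by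
  have hi := MemLp.intervalIntegrable_of_mem hψ ht
  have hc := intervalIntegral.continuousOn_primitive_interval' hi left_mem_uIcc
  have h1 : Tendsto (fun s => ∫ τ in (0 : ℝ)..s, ψ τ) (𝓝[>] 0) (𝓝 0) := by
    have h2 := hc 0 left_mem_uIcc
    rw [ContinuousWithinAt, intervalIntegral.integral_same] at h2
    refine h2.mono_left (nhdsWithin_le_of_mem ?_)
    rw [uIcc_of_le ht.1.le]
    exact mem_of_superset (Ioo_mem_nhdsGT ht.1) Ioo_subset_Icc_self
  have h3 : Tendsto (fun s => φ s + ((∫ τ in (0 : ℝ)..t, ψ τ) - ∫ τ in (0 : ℝ)..s, ψ τ)) (𝓝[>] 0)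
      (𝓝 (φ₀ + ((∫ τ in (0 : ℝ)..t, ψ τ) - 0))) := h0.add (tendsto_const_nhds.sub h1)
  rw [sub_zero] at h3
  refine tendsto_nhds_unique_of_eventuallyEq tendsto_const_nhds h3 ?_
  filter_upwards [Ioo_mem_nhdsGT ht.1] with s hs
  have hsT : s ∈ timeInterval T := timeInterval_mono_right ht hs.1 hs.2.le
  rw [intervalIntegral.integral_interval_sub_left hi (MemLp.intervalIntegrable_of_mem hψ hsT),
    ← h.2 s hsT t ht]
  abel

lemma eLpNorm_two_sq {α X : Type*} {m : MeasurableSpace α} {μ : Measure α} [NormedAddCommGroup X]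
    (f : α → X) : eLpNorm f 2 μ ^ 2 = ∫⁻ t, ‖f t‖ₑ ^ 2 ∂μ := by
  have h := eLpNorm_nnreal_pow_eq_lintegral (μ := μ) (f := f) (p := 2) two_ne_zero
  simpa using h

lemma add_le_sqrt_two_mul_of_sq_add_sq_le {a g f s : ENNReal} (h : a ^ 2 + g ^ 2 ≤ f ^ 2 + s ^ 2) :
    a + g ≤ ENNReal.ofReal √2 * s + ENNReal.ofReal √2 * f := by
  by_cases hf : f = ⊤
  · simp [hf, ENNReal.mul_top]
  by_cases hs : s = ⊤
  · simp [hs, ENNReal.mul_top]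
  have hfin : f ^ 2 + s ^ 2 ≠ ⊤ :=
    ENNReal.add_ne_top.2 ⟨ENNReal.pow_ne_top hf, ENNReal.pow_ne_top hs⟩
  have hag := ENNReal.add_ne_top.1 (ne_top_of_le_ne_top hfin h)
  have ha : a ≠ ⊤ := fun h => hag.1 (by simp [h])
  have hg : g ≠ ⊤ := fun h => hag.2 (by simp [h])
  lift f to NNReal using hf
  lift s to NNReal using hs
  lift a to NNReal using ha
  lift g to NNReal using hg
  have h' : (a : ℝ) ^ 2 + (g : ℝ) ^ 2 ≤ (f : ℝ) ^ 2 + (s : ℝ) ^ 2 := by exact_mod_cast h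
  have h2 : (a : ℝ) + g ≤ √2 * s + √2 * f := by
    have hsq : √2 ^ 2 = 2 := Real.sq_sqrt zero_le_two
    refine (sq_le_sq₀ (by positivity) (by positivity)).1 ?_
    have e : (√2 * (s : ℝ) + √2 * f) ^ 2 = 2 * ((s : ℝ) + f) ^ 2 := by
      rw [← mul_add, mul_pow, hsq]
    rw [e]
    nlinarith [sq_nonneg ((a : ℝ) - g), mul_nonneg s.coe_nonneg f.coe_nonneg]
  have e3 : ENNReal.ofReal √2 = ((√2).toNNReal : ENNReal) := rfl
  rw [e3]
  have h4 : a + g ≤ (√2).toNNReal * s + (√2).toNNReal * f := by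
    rw [← NNReal.coe_le_coe]
    push_cast
    rw [Real.coe_toNNReal _ (Real.sqrt_nonneg 2)]
    exact h2
  exact_mod_cast h4

/-- Maximal regularity in `L²` holds with the constant `√2`. -/
lemma isMaxRegConst_sqrt_two {A : H →ₗ.[ℂ] H} (hA : IsSelfAdjoint A) (hA0 : IsNonnegOp A) :
    IsMaxRegConst A √2 := by
  refine ⟨by positivity, fun T _ F hF V₀ V hV hVF hV0 => ?_⟩
  have hS := isNonnegSqrt_opSqrt hA hA0
  have hD := timeDeriv_spec hV.differentiable
  have hSV : opSqrt A V₀ = opApply (opSqrt A) (V₀ : H) := (opApply_of_mem V₀.2).symm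
  have hmeas : AEMeasurable (fun t => ‖timeDeriv T V t‖ₑ ^ 2) (timeMeasure T) :=
    hV.memLp_deriv.1.enorm.pow_const 2
  have key : ∫⁻ t, (‖timeDeriv T V t‖ₑ ^ 2 + ‖opApply A (V t)‖ₑ ^ 2) ∂(timeMeasure T) ≤
      (∫⁻ t, ‖F t‖ₑ ^ 2 ∂(timeMeasure T)) + ‖opApply (opSqrt A) (V₀ : H)‖ₑ ^ 2 := by
    refine lintegral_timeMeasure_le fun b hb => ?_
    have hle := restrict_Ioc_le_timeMeasure hb
    set W : ℝ → H := fun t => V₀ + ∫ τ in (0 : ℝ)..t, timeDeriv T V τ with hW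
    have hWV : ∀ t ∈ Ioc 0 b, W t = V t := fun t ht =>
      (hD.eq_add_integral hV.memLp_deriv hV0 (Ioc_subset_timeInterval hb ht)).symm
    have hWV' : ∀ᵐ t ∂(volume.restrict (Ioc 0 b)), W t = V t :=
      (ae_restrict_iff' measurableSet_Ioc).2 (Eventually.of_forall hWV)
    have hdom : ∀ᵐ t ∂(volume.restrict (Ioc 0 b)), V t ∈ A.domain :=
      hV.mem_domain.filter_mono (ae_mono hle)
    have hGW : (fun t => opApply A (V t)) =ᵐ[volume.restrict (Ioc 0 b)]
        fun t => opApply A (W t) := by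
      filter_upwards [hWV'] with t ht
      rw [ht]
    have h := lintegral_energy_le hA hA0 hS hb.1.le V₀.2 (hV.memLp_deriv.mono_measure hle)
      (fun t _ => rfl) (by filter_upwards [hWV', hdom] with t h1 h2; rw [← h1] at h2; exact h2)
      ((memLp_congr_ae hGW).1 (hV.memLp_op.mono_measure hle))
    rw [lintegral_add_left' (hmeas.mono_measure hle)]
    have e1 : ∫⁻ t in Ioc 0 b, ‖opApply A (V t)‖ₑ ^ 2 = ∫⁻ t in Ioc 0 b, ‖opApply A (W t)‖ₑ ^ 2 := by
      refine lintegral_congr_ae ?_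
      filter_upwards [hGW] with t ht
      rw [ht]
    have e2 : ∫⁻ t in Ioc 0 b, ‖timeDeriv T V t + opApply A (W t)‖ₑ ^ 2 =
        ∫⁻ t in Ioc 0 b, ‖F t‖ₑ ^ 2 := by
      refine lintegral_congr_ae ?_
      filter_upwards [hGW, hVF.filter_mono (ae_mono hle)] with t h1 h2
      rw [← h1, h2]
    rw [e1]
    refine h.trans ?_
    rw [e2]
    gcongr
  rw [lintegral_add_left' hmeas, ← eLpNorm_two_sq, ← eLpNorm_two_sq, ← eLpNorm_two_sq] at key
  refine (add_le_sqrt_two_mul_of_sq_add_sq_le key).trans_eq ?_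
  rw [ENNReal.ofReal_mul (Real.sqrt_nonneg 2), hSV, ofReal_norm]

end

/-! ### The semigroup -/

lemma opApply_neg {A : H →ₗ.[ℂ] H} {x : H} (hx : x ∈ A.domain) :
    (x, -opApply A x) ∈ (-A).graph := by
  have h : x ∈ (-A).domain := hx
  refine mem_graph_iff_opApply.2 ⟨h, ?_⟩
  rw [opApply_of_mem h, opApply_of_mem hx]
  rfl

namespace C0Semigroup

variable {E : C0Semigroup H} {A : H →ₗ.[ℂ] H}

lemma norm_apply_le (hEc : E.IsContraction) {t : ℝ} (ht : 0 ≤ t) (x : H) :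
    ‖E.toFun t x‖ ≤ ‖x‖ :=
  ((E.toFun t).le_of_opNorm_le (hEc t ht) x).trans_eq (one_mul _)

lemma continuousOn_Ioi (hEa : E.IsBoundedAnalytic) : ContinuousOn E.toFun (Ioi 0) := by
  obtain ⟨δ, hδ, -, Z, hZ, hZd, -⟩ := hEa
  have hmaps : MapsTo (fun t : ℝ => (t : ℂ)) (Ioi 0) (openSector δ) := by
    intro t ht
    rw [mem_Ioi] at ht
    refine ⟨Complex.ofReal_ne_zero.2 ht.ne', ?_⟩
    rw [Complex.arg_ofReal_of_nonneg ht.le, abs_zero]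
    exact hδ
  exact (hZd.continuousOn.comp Complex.continuous_ofReal.continuousOn hmaps).congr
    fun t ht => (hZ t ht).symm

lemma apply_zero (x : H) : E.toFun 0 x = x := by rw [E.map_zero]; rfl

lemma apply_add {s t : ℝ} (hs : 0 ≤ s) (ht : 0 ≤ t) (x : H) :
    E.toFun (s + t) x = E.toFun s (E.toFun t x) := by rw [E.map_add s t hs ht]; rfl

lemma apply_comm {s t : ℝ} (hs : 0 ≤ s) (ht : 0 ≤ t) (x : H) :
    E.toFun s (E.toFun t x) = E.toFun t (E.toFun s x) := by
  rw [← apply_add hs ht, ← apply_add ht hs, add_comm]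

lemma continuousOn_apply (hEa : E.IsBoundedAnalytic) (x : H) :
    ContinuousOn (fun t => E.toFun t x) (Ici 0) := by
  intro t ht
  rcases (mem_Ici.1 ht).eq_or_lt with rfl | h
  · rw [← Ioi_insert]
    refine ContinuousWithinAt.insert ?_
    rw [ContinuousWithinAt, apply_zero]
    exact E.tendsto_zero x
  · have := ((continuousOn_Ioi hEa).clm_apply (continuousOn_const (c := x))).continuousAt
      (Ioi_mem_nhds h)
    exact this.continuousWithinAt

lemma graph_apply (hE : E.IsGenerator (-A)) {t : ℝ} (ht : 0 ≤ t) {x : H} (hx : x ∈ A.domain) :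
    E.toFun t x ∈ A.domain ∧ opApply A (E.toFun t x) = E.toFun t (opApply A x) := by
  have h1 := (hE _ _).1 (opApply_neg hx)
  have h2 : (E.toFun t x, E.toFun t (-opApply A x)) ∈ (-A).graph := by
    rw [hE]
    refine (((E.toFun t).continuous.tendsto _).comp h1).congr' ?_
    filter_upwards [self_mem_nhdsWithin] with h hh
    rw [mem_Ioi] at hh
    rw [Function.comp_apply, ← Complex.coe_smul, map_smul, map_sub, apply_comm ht hh.le,
      Complex.coe_smul]
  have h3 : E.toFun t x ∈ A.domain :=
    LinearPMap.mem_domain_of_mem_graph (f := -A) h2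
  refine ⟨h3, ?_⟩
  have := LinearPMap.mem_graph_snd_inj _ (opApply_neg h3) h2 rfl
  rw [map_neg] at this
  exact neg_injective this

lemma hasDerivWithinAt_apply (hE : E.IsGenerator (-A)) {t : ℝ} (ht : 0 ≤ t) {x : H}
    (hx : x ∈ A.domain) :
    HasDerivWithinAt (fun s => E.toFun s x) (-E.toFun t (opApply A x)) (Ioi t) t := by
  rw [hasDerivWithinAt_iff_tendsto_slope' self_notMem_Ioi]
  have h1 := (hE _ _).1 (opApply_neg hx)
  have h2 := ((E.toFun t).continuous.tendsto _).comp h1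
  rw [map_neg] at h2
  have h3 : Tendsto (fun s : ℝ => s - t) (𝓝[>] t) (𝓝[>] 0) := by
    refine tendsto_nhdsWithin_iff.2 ⟨?_, ?_⟩
    · have : Tendsto (fun s : ℝ => s - t) (𝓝 t) (𝓝 (t - t)) := tendsto_id.sub_const t
      rw [sub_self] at this
      exact this.mono_left nhdsWithin_le_nhds
    · filter_upwards [self_mem_nhdsWithin] with s hs using mem_Ioi.2 (sub_pos.2 (mem_Ioi.1 hs))
  refine (h2.comp h3).congr' ?_
  filter_upwards [self_mem_nhdsWithin] with s hs
  have hst : 0 ≤ s - t := (sub_pos.2 (mem_Ioi.1 hs)).le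
  rw [Function.comp_apply, Function.comp_apply, slope_def_module, ← Complex.coe_smul, map_smul,
    map_sub, ← apply_add ht hst, add_sub_cancel, Complex.coe_smul]

variable [CompleteSpace H]

lemma intervalIntegrable_apply (hEa : E.IsBoundedAnalytic) (x : H) {t : ℝ} (ht : 0 ≤ t) :
    IntervalIntegrable (fun s => E.toFun s x) volume 0 t :=
  ((continuousOn_apply hEa x).mono (by
    rw [uIcc_of_le ht]; exact fun s hs => hs.1)).intervalIntegrable

lemma apply_eq_sub_integral (hE : E.IsGenerator (-A)) (hEa : E.IsBoundedAnalytic) {t : ℝ}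
    (ht : 0 ≤ t) {x : H} (hx : x ∈ A.domain) :
    E.toFun t x = x - ∫ s in (0 : ℝ)..t, E.toFun s (opApply A x) := by
  have h := intervalIntegral.integral_eq_sub_of_hasDeriv_right
    (f := fun s => E.toFun s x) (f' := fun s => -E.toFun s (opApply A x)) (a := 0) (b := t)
    ((continuousOn_apply hEa x).mono (by rw [uIcc_of_le ht]; exact fun s hs => hs.1))
    (fun s hs => by
      rw [min_eq_left ht] at hs
      exact hasDerivWithinAt_apply hE hs.1.le hx)
    (intervalIntegrable_apply hEa _ ht).neg
  rw [intervalIntegral.integral_neg, apply_zero] at h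
  rw [sub_eq_add_neg, h]
  abel

lemma resolventOp_apply (hE : E.IsGenerator (-A)) (hA : IsSelfAdjoint A) (hA0 : IsNonnegOp A)
    {l : ℝ} (hl : 0 < l) {t : ℝ} (ht : 0 ≤ t) (x : H) :
    resolventOp A l (E.toFun t x) = E.toFun t (resolventOp A l x) := by
  have hJ := isResolvent_resolventOp hA hA0 hl
  obtain ⟨h1, h2⟩ := graph_apply hE ht (hJ.mem x)
  refine hJ.eq_of_add_smul hA0 hl h1 ?_
  rw [h2, ← map_smul, ← _root_.map_add, hJ.add_smul]

lemma yosidaOp_apply (hE : E.IsGenerator (-A)) (hA : IsSelfAdjoint A) (hA0 : IsNonnegOp A)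
    {l : ℝ} (hl : 0 < l) {t : ℝ} (ht : 0 ≤ t) (x : H) :
    yosidaOp A l (E.toFun t x) = E.toFun t (yosidaOp A l x) := by
  simp only [yosidaOp, _root_.smul_apply, _root_.sub_apply, ContinuousLinearMap.id_apply,
    map_smul, map_sub, resolventOp_apply hE hA hA0 hl ht]

lemma resolventOp_apply_eq_sub (hE : E.IsGenerator (-A)) (hEa : E.IsBoundedAnalytic)
    (hA : IsSelfAdjoint A) (hA0 : IsNonnegOp A) {l : ℝ} (hl : 0 < l) {t : ℝ} (ht : 0 ≤ t) (x : H) :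
    resolventOp A l (E.toFun t x) =
      resolventOp A l x - yosidaOp A l (∫ s in (0 : ℝ)..t, E.toFun s x) := by
  have hJ := isResolvent_resolventOp hA hA0 hl
  rw [resolventOp_apply hE hA hA0 hl ht, apply_eq_sub_integral hE hEa ht (hJ.mem x),
    opApply_resolventOp hA hA0 hl,
    ← ContinuousLinearMap.intervalIntegral_comp_comm _ (intervalIntegrable_apply hEa x ht)]
  congr 1
  refine intervalIntegral.integral_congr fun s hs => ?_
  rw [uIcc_of_le ht] at hs
  exact (yosidaOp_apply hE hA hA0 hl hs.1 x).symm

/-! ### Convolution with the semigroup -/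

/-- The mild solution of `V' + A V = F`, `V(0) = V₀`. -/
def mildSolution (E : C0Semigroup H) (F : ℝ → H) (V₀ : H) (t : ℝ) : H :=
  E.toFun t V₀ + ∫ τ in (0 : ℝ)..t, E.toFun (t - τ) (F τ)

variable {F : ℝ → H}

lemma aestronglyMeasurable_apply_sub (hEa : E.IsBoundedAnalytic) {t : ℝ}
    (hF : AEStronglyMeasurable F (volume.restrict (Ioc 0 t))) :
    AEStronglyMeasurable (fun τ => E.toFun (t - τ) (F τ)) (volume.restrict (Ioc 0 t)) := by
  rw [← restrict_Ioo_eq_restrict_Ioc] at hF ⊢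
  have h : ContinuousOn (fun τ => E.toFun (t - τ)) (Ioo 0 t) :=
    (continuousOn_Ioi hEa).comp (continuous_const.sub continuous_id).continuousOn
      fun τ hτ => sub_pos.2 hτ.2
  exact (ContinuousLinearMap.id ℂ (H →L[ℂ] H)).aestronglyMeasurable_comp₂
    (h.aestronglyMeasurable measurableSet_Ioo) hF

lemma intervalIntegrable_apply_sub (hEa : E.IsBoundedAnalytic) (hEc : E.IsContraction) {t : ℝ}
    (ht : 0 ≤ t) (hF : IntervalIntegrable F volume 0 t) :
    IntervalIntegrable (fun τ => E.toFun (t - τ) (F τ)) volume 0 t := by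
  rw [intervalIntegrable_iff_integrableOn_Ioc_of_le ht] at hF ⊢
  refine Integrable.mono' hF.norm (aestronglyMeasurable_apply_sub hEa hF.1) ?_
  refine (ae_restrict_iff' measurableSet_Ioc).2 (Eventually.of_forall fun τ hτ => ?_)
  exact norm_apply_le hEc (sub_nonneg.2 hτ.2) _

lemma norm_integral_apply_sub_le (hEc : E.IsContraction) {t : ℝ} (ht : 0 ≤ t)
    (hF : IntervalIntegrable F volume 0 t) :
    ‖∫ τ in (0 : ℝ)..t, E.toFun (t - τ) (F τ)‖ ≤ ∫ τ in (0 : ℝ)..t, ‖F τ‖ :=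
  intervalIntegral.norm_integral_le_of_norm_le ht
    (Eventually.of_forall fun _ hτ => norm_apply_le hEc (sub_nonneg.2 hτ.2) _) hF.norm

lemma integrableOn_convolution (hEa : E.IsBoundedAnalytic) (hEc : E.IsContraction) {t : ℝ}
    (ht : 0 ≤ t) (hF : IntervalIntegrable F volume 0 t) :
    IntegrableOn (Function.uncurry fun τ s => (Ioi (0 : ℝ)).indicator E.toFun (s - τ) (F τ))
      (uIoc 0 t ×ˢ uIoc 0 t) := by
  rw [uIoc_of_le ht]
  rw [intervalIntegrable_iff_integrableOn_Ioc_of_le ht] at hF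
  rw [IntegrableOn, Measure.volume_eq_prod, ← Measure.prod_restrict]
  refine Integrable.mono' (hF.norm.comp_fst (volume.restrict (Ioc 0 t))) ?_ ?_
  · have h1 : AEStronglyMeasurable ((Ioi (0 : ℝ)).indicator E.toFun) volume :=
      (aestronglyMeasurable_indicator_iff measurableSet_Ioi).2
        ((continuousOn_Ioi hEa).aestronglyMeasurable measurableSet_Ioi)
    have h2 : AEStronglyMeasurable (fun p : ℝ × ℝ => (Ioi (0 : ℝ)).indicator E.toFun (p.2 - p.1))
        ((volume.restrict (Ioc 0 t)).prod (volume.restrict (Ioc 0 t))) := by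
      have h3 := h1.comp_quasiMeasurePreserving
        (quasiMeasurePreserving_sub_of_right_invariant (volume : Measure ℝ) (volume : Measure ℝ))
      have h4 := h3.prod_swap
      refine h4.mono_measure ?_
      rw [Measure.prod_restrict]
      exact Measure.restrict_le_self
    exact (ContinuousLinearMap.id ℂ (H →L[ℂ] H)).aestronglyMeasurable_comp₂ h2 hF.1.comp_fst
  · refine Eventually.of_forall fun p => ?_
    by_cases h : p.2 - p.1 ∈ Ioi (0 : ℝ)
    · simp only [Function.uncurry, indicator_of_mem h]
      exact norm_apply_le hEc (mem_Ioi.1 h).le _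
    · simp only [Function.uncurry, indicator_of_notMem h]
      simp

lemma integral_indicator_left {t s : ℝ} (hs : s ∈ uIcc 0 t) (ht : 0 ≤ t) :
    ∫ τ in (0 : ℝ)..t, (Ioi (0 : ℝ)).indicator E.toFun (s - τ) (F τ) =
      ∫ τ in (0 : ℝ)..s, E.toFun (s - τ) (F τ) := by
  rw [uIcc_of_le ht] at hs
  rw [intervalIntegral.integral_of_le ht, intervalIntegral.integral_of_le hs.1,
    integral_Ioc_eq_integral_Ioo (y := s), ← integral_indicator measurableSet_Ioc,
    ← integral_indicator measurableSet_Ioo]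
  congr 1
  ext τ
  by_cases h1 : τ ∈ Ioo 0 s
  · rw [indicator_of_mem h1, indicator_of_mem (show τ ∈ Ioc 0 t from ⟨h1.1, h1.2.le.trans hs.2⟩),
      indicator_of_mem (show s - τ ∈ Ioi 0 from sub_pos.2 h1.2)]
  · rw [indicator_of_notMem h1]
    by_cases h2 : τ ∈ Ioc 0 t
    · have h3 : s - τ ∉ Ioi (0 : ℝ) := fun h => h1 ⟨h2.1, sub_pos.1 (mem_Ioi.1 h)⟩
      rw [indicator_of_mem h2, indicator_of_notMem h3]
      simp
    · rw [indicator_of_notMem h2]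

lemma integral_indicator_right {t τ : ℝ} (hτ : τ ∈ uIcc 0 t) (ht : 0 ≤ t) :
    ∫ s in (0 : ℝ)..t, (Ioi (0 : ℝ)).indicator E.toFun (s - τ) (F τ) =
      ∫ s in (0 : ℝ)..(t - τ), E.toFun s (F τ) := by
  rw [uIcc_of_le ht] at hτ
  have e := intervalIntegral.integral_comp_sub_right (a := τ) (b := t)
    (fun s => E.toFun s (F τ)) τ
  rw [sub_self] at e
  rw [← e,
    intervalIntegral.integral_of_le ht, intervalIntegral.integral_of_le hτ.2,
    ← integral_indicator measurableSet_Ioc, ← integral_indicator measurableSet_Ioc]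
  congr 1
  ext s
  by_cases h1 : s ∈ Ioc τ t
  · rw [indicator_of_mem h1, indicator_of_mem (show s ∈ Ioc 0 t from ⟨hτ.1.trans_lt h1.1, h1.2⟩),
      indicator_of_mem (show s - τ ∈ Ioi 0 from sub_pos.2 h1.1)]
  · rw [indicator_of_notMem h1]
    by_cases h2 : s ∈ Ioc 0 t
    · have h3 : s - τ ∉ Ioi (0 : ℝ) := fun h => h1 ⟨sub_pos.1 (mem_Ioi.1 h), h2.2⟩
      rw [indicator_of_mem h2, indicator_of_notMem h3]
      simp
    · rw [indicator_of_notMem h2]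

/-- Fubini's theorem for the convolution with the semigroup. -/
lemma integral_convolution (hEa : E.IsBoundedAnalytic) (hEc : E.IsContraction) {t : ℝ}
    (ht : 0 ≤ t) (hF : IntervalIntegrable F volume 0 t) :
    IntervalIntegrable (fun s => ∫ τ in (0 : ℝ)..s, E.toFun (s - τ) (F τ)) volume 0 t ∧
    IntervalIntegrable (fun τ => ∫ s in (0 : ℝ)..(t - τ), E.toFun s (F τ)) volume 0 t ∧
    ∫ τ in (0 : ℝ)..t, ∫ s in (0 : ℝ)..(t - τ), E.toFun s (F τ) =
      ∫ s in (0 : ℝ)..t, ∫ τ in (0 : ℝ)..s, E.toFun (s - τ) (F τ) := by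
  have h := integrableOn_convolution hEa hEc ht hF
  have h' := h
  rw [uIoc_of_le ht, IntegrableOn, Measure.volume_eq_prod, ← Measure.prod_restrict] at h'
  have hr := h'.integral_prod_right
  have hl := h'.integral_prod_left
  simp only [Function.uncurry, ← intervalIntegral.integral_of_le ht] at hr hl
  have hsub : Ioc 0 t ⊆ uIcc 0 t := by
    rw [uIcc_of_le ht]
    exact Ioc_subset_Icc_self
  refine ⟨?_, ?_, ?_⟩
  · rw [intervalIntegrable_iff_integrableOn_Ioc_of_le ht]
    refine IntegrableOn.congr_fun hr (fun s hs => ?_) measurableSet_Ioc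
    exact integral_indicator_left (hsub hs) ht
  · rw [intervalIntegrable_iff_integrableOn_Ioc_of_le ht]
    refine IntegrableOn.congr_fun hl (fun s hs => ?_) measurableSet_Ioc
    exact integral_indicator_right (hsub hs) ht
  · have e := intervalIntegral_intervalIntegral_swap h
    rw [intervalIntegral.integral_congr fun s hs => integral_indicator_right hs ht] at e
    rw [e]
    exact intervalIntegral.integral_congr fun s hs => integral_indicator_left hs ht

lemma intervalIntegrable_mildSolution (hEa : E.IsBoundedAnalytic) (hEc : E.IsContraction) {t : ℝ}
    (ht : 0 ≤ t) (hF : IntervalIntegrable F volume 0 t) (V₀ : H) :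
    IntervalIntegrable (E.mildSolution F V₀) volume 0 t :=
  (intervalIntegrable_apply hEa V₀ ht).add (integral_convolution hEa hEc ht hF).1

lemma resolventOp_mildSolution (hE : E.IsGenerator (-A)) (hEa : E.IsBoundedAnalytic)
    (hEc : E.IsContraction) (hA : IsSelfAdjoint A) (hA0 : IsNonnegOp A) {l : ℝ} (hl : 0 < l)
    {t : ℝ} (ht : 0 ≤ t) (hF : IntervalIntegrable F volume 0 t) (V₀ : H) :
    resolventOp A l (E.mildSolution F V₀ t) = resolventOp A l V₀ +
      ∫ τ in (0 : ℝ)..t, (resolventOp A l (F τ) - yosidaOp A l (E.mildSolution F V₀ τ)) := by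
  obtain ⟨h1, h2, h3⟩ := integral_convolution hEa hEc ht hF
  have hJF : IntervalIntegrable (fun τ => resolventOp A l (F τ)) volume 0 t :=
    ⟨(resolventOp A l).integrable_comp hF.1, (resolventOp A l).integrable_comp hF.2⟩
  have hY : ∀ {g : ℝ → H}, IntervalIntegrable g volume 0 t →
      IntervalIntegrable (fun τ => yosidaOp A l (g τ)) volume 0 t := fun hg =>
    ⟨(yosidaOp A l).integrable_comp hg.1, (yosidaOp A l).integrable_comp hg.2⟩
  have hV := intervalIntegrable_mildSolution hEa hEc ht hF V₀
  have e1 : resolventOp A l (∫ τ in (0 : ℝ)..t, E.toFun (t - τ) (F τ)) =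
      (∫ τ in (0 : ℝ)..t, resolventOp A l (F τ)) -
        yosidaOp A l (∫ s in (0 : ℝ)..t, ∫ τ in (0 : ℝ)..s, E.toFun (s - τ) (F τ)) := by
    rw [← h3, ← ContinuousLinearMap.intervalIntegral_comp_comm _ h2,
      ← intervalIntegral.integral_sub hJF (hY h2),
      ← ContinuousLinearMap.intervalIntegral_comp_comm _
        (intervalIntegrable_apply_sub hEa hEc ht hF)]
    refine intervalIntegral.integral_congr fun τ hτ => ?_
    rw [uIcc_of_le ht] at hτ
    exact resolventOp_apply_eq_sub hE hEa hA hA0 hl (sub_nonneg.2 hτ.2) _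
  rw [intervalIntegral.integral_sub hJF (hY hV),
    ContinuousLinearMap.intervalIntegral_comp_comm (yosidaOp A l) hV]
  have e2 : ∫ τ in (0 : ℝ)..t, E.mildSolution F V₀ τ = (∫ s in (0 : ℝ)..t, E.toFun s V₀) +
      ∫ s in (0 : ℝ)..t, ∫ τ in (0 : ℝ)..s, E.toFun (s - τ) (F τ) :=
    intervalIntegral.integral_add (intervalIntegrable_apply hEa V₀ ht) h1
  rw [e2, _root_.map_add, mildSolution, _root_.map_add, e1, resolventOp_apply_eq_sub hE hEa hA hA0 hl ht]
  abel

end C0Semigroup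

/-! ### Maximal regularity of the mild solution -/

namespace C0Semigroup

variable [CompleteSpace H] {E : C0Semigroup H} {A : H →ₗ.[ℂ] H} {T : EReal} {F : ℝ → H}

lemma norm_mildSolution_le (hEc : E.IsContraction) {t : ℝ} (ht : 0 ≤ t)
    (hF : IntervalIntegrable F volume 0 t) (V₀ : H) :
    ‖E.mildSolution F V₀ t‖ ≤ ‖V₀‖ + ∫ τ in (0 : ℝ)..t, ‖F τ‖ :=
  (norm_add_le _ _).trans
    (add_le_add (norm_apply_le hEc ht V₀) (norm_integral_apply_sub_le hEc ht hF))

lemma memLp_mildSolution (hEa : E.IsBoundedAnalytic) (hEc : E.IsContraction) {b : ℝ}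
    (hb : 0 ≤ b) (hF : IntervalIntegrable F volume 0 b) (V₀ : H) :
    MemLp (E.mildSolution F V₀) 2 (volume.restrict (Ioc 0 b)) := by
  have hV := (intervalIntegrable_iff_integrableOn_Ioc_of_le hb).1
    (intervalIntegrable_mildSolution hEa hEc hb hF V₀)
  refine MemLp.of_bound hV.1 (‖V₀‖ + ∫ τ in (0 : ℝ)..b, ‖F τ‖) ?_
  refine (ae_restrict_iff' measurableSet_Ioc).2 (Eventually.of_forall fun t ht => ?_)
  have hsub : uIcc 0 t ⊆ uIcc 0 b := by
    rw [uIcc_of_le ht.1.le, uIcc_of_le hb]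
    exact Icc_subset_Icc_right ht.2
  refine (norm_mildSolution_le hEc ht.1.le (hF.mono_set hsub) V₀).trans ?_
  gcongr
  exact intervalIntegral.integral_mono_interval le_rfl ht.1.le ht.2
    (Eventually.of_forall fun _ => norm_nonneg _) hF.norm

lemma aestronglyMeasurable_mildSolution (hEa : E.IsBoundedAnalytic) (hEc : E.IsContraction)
    (hF : MemLp F 2 (timeMeasure T)) (V₀ : H) :
    AEStronglyMeasurable (E.mildSolution F V₀) (timeMeasure T) := by
  rw [timeMeasure, timeInterval_eq_iUnion, aestronglyMeasurable_iUnion_iff]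
  exact fun q => (memLp_mildSolution hEa hEc q.2.1.le
    (MemLp.intervalIntegrable_of_mem hF q.2) V₀).1

lemma lintegral_yosidaOp_mildSolution_le (hE : E.IsGenerator (-A)) (hEa : E.IsBoundedAnalytic)
    (hEc : E.IsContraction) (hA : IsSelfAdjoint A) (hA0 : IsNonnegOp A) {S : H →ₗ.[ℂ] H}
    (hS : IsNonnegSqrt A S) {V₀ : H} (hV₀ : V₀ ∈ S.domain) (hF : MemLp F 2 (timeMeasure T))
    {l : ℝ} (hl : 0 < l) :
    ∫⁻ t, ‖yosidaOp A l (E.mildSolution F V₀ t)‖ₑ ^ 2 ∂(timeMeasure T) ≤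
      (∫⁻ t, ‖F t‖ₑ ^ 2 ∂(timeMeasure T)) + ‖opApply S V₀‖ₑ ^ 2 := by
  refine lintegral_timeMeasure_le fun b hb => ?_
  have hJ := isResolvent_resolventOp hA hA0 hl
  have hFb := MemLp.restrict_Ioc hF hb
  have hV := memLp_mildSolution hEa hEc hb.1.le (MemLp.intervalIntegrable_of_mem hF hb) V₀
  have hJF : MemLp (fun t => resolventOp A l (F t)) 2 (volume.restrict (Ioc 0 b)) :=
    (resolventOp A l).comp_memLp' hFb
  have hYV : MemLp (fun t => yosidaOp A l (E.mildSolution F V₀ t)) 2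
      (volume.restrict (Ioc 0 b)) := (yosidaOp A l).comp_memLp' hV
  have hAW : ∀ t, opApply A (resolventOp A l (E.mildSolution F V₀ t)) =
      yosidaOp A l (E.mildSolution F V₀ t) := fun t => opApply_resolventOp hA hA0 hl _
  have h := lintegral_energy_le hA hA0 hS hb.1.le
    (W := fun t => resolventOp A l (E.mildSolution F V₀ t))
    (ψ := fun t => resolventOp A l (F t) - yosidaOp A l (E.mildSolution F V₀ t))
    (hS.mem_domain (hJ.mem V₀)).1 (hJF.sub hYV)
    (fun t ht => resolventOp_mildSolution hE hEa hEc hA hA0 hl ht.1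
      ((MemLp.intervalIntegrable_of_mem hF hb).mono_set (by
        rw [uIcc_of_le ht.1, uIcc_of_le hb.1.le]
        exact Icc_subset_Icc_right ht.2)) V₀)
    (Eventually.of_forall fun t => hJ.mem _)
    (by simp only [hAW]; exact hYV)
  simp only [hAW, sub_add_cancel] at h
  have hnorm : ∀ {x y : H}, ‖x‖ ≤ ‖y‖ → ‖x‖ₑ ^ 2 ≤ ‖y‖ₑ ^ 2 := fun hxy => by
    gcongr
    exact enorm_le_iff_norm_le.2 hxy
  calc _ ≤ (∫⁻ t in Ioc 0 b, ‖resolventOp A l (F t)‖ₑ ^ 2) +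
        ‖opApply S (resolventOp A l V₀)‖ₑ ^ 2 := le_add_self.trans h
    _ ≤ _ := by
      refine add_le_add ?_ (hnorm (hS.resolventOp_le hA hA0 hl hV₀).1)
      exact lintegral_mono' (restrict_Ioc_le_timeMeasure hb)
        fun t => hnorm (hJ.norm_apply_le hA0 hl _)

lemma mildSolution_mem_domain (hE : E.IsGenerator (-A)) (hEa : E.IsBoundedAnalytic)
    (hEc : E.IsContraction) (hA : IsSelfAdjoint A) (hA0 : IsNonnegOp A) {S : H →ₗ.[ℂ] H}
    (hS : IsNonnegSqrt A S) {V₀ : H} (hV₀ : V₀ ∈ S.domain) (hF : MemLp F 2 (timeMeasure T)) :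
    (∀ᵐ t ∂(timeMeasure T), E.mildSolution F V₀ t ∈ A.domain) ∧
      MemLp (fun t => opApply A (E.mildSolution F V₀ t)) 2 (timeMeasure T) := by
  set l : ℕ → ℝ := fun n => 1 / ((n : ℝ) + 1) with hl
  have hlpos : ∀ n, 0 < l n := fun n => by simp only [hl]; positivity
  have hl1 : Tendsto l atTop (𝓝 0) := tendsto_one_div_add_atTop_nhds_zero_nat
  have hl0 : Tendsto l atTop (𝓝[>] 0) :=
    tendsto_nhdsWithin_iff.2 ⟨hl1, Eventually.of_forall hlpos⟩
  set V := E.mildSolution F V₀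
  set K : ENNReal := (∫⁻ t, ‖F t‖ₑ ^ 2 ∂(timeMeasure T)) + ‖opApply S V₀‖ₑ ^ 2 with hK
  have hKtop : K < ⊤ := by
    rw [hK, ← eLpNorm_two_sq]
    exact ENNReal.add_lt_top.2 ⟨ENNReal.pow_lt_top hF.2, ENNReal.pow_lt_top enorm_lt_top⟩
  have hVm := aestronglyMeasurable_mildSolution hEa hEc hF V₀
  have hYm : ∀ n, AEStronglyMeasurable (fun t => yosidaOp A (l n) (V t)) (timeMeasure T) :=
    fun n => (yosidaOp A (l n)).continuous.comp_aestronglyMeasurable hVm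
  have hmeas : ∀ n, AEMeasurable (fun t => ‖yosidaOp A (l n) (V t)‖ₑ ^ 2) (timeMeasure T) :=
    fun n => (hYm n).enorm.pow_const 2
  have hfatou : ∫⁻ t, liminf (fun n => ‖yosidaOp A (l n) (V t)‖ₑ ^ 2) atTop ∂(timeMeasure T) ≤ K :=
    (lintegral_liminf_le' hmeas).trans (liminf_le_of_le (by isBoundedDefault) fun b hb => by
      obtain ⟨n, hn⟩ := hb.exists
      exact hn.trans (lintegral_yosidaOp_mildSolution_le hE hEa hEc hA hA0 hS hV₀ hF (hlpos n)))
  have hliminf : AEMeasurable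
      (fun t => liminf (fun n => ‖yosidaOp A (l n) (V t)‖ₑ ^ 2) atTop) (timeMeasure T) := by
    simp only [liminf_eq_iSup_iInf_of_nat']
    exact AEMeasurable.iSup fun n => AEMeasurable.iInf fun i => hmeas (i + n)
  have hdom : ∀ᵐ t ∂(timeMeasure T), V t ∈ A.domain := by
    filter_upwards [ae_lt_top' hliminf (hfatou.trans_lt hKtop).ne] with t ht
    obtain ⟨M, hM1, hM2⟩ := ENNReal.lt_iff_exists_nnreal_btwn.1 ht
    have hfr : ∃ᶠ n in atTop, ‖yosidaOp A (l n) (V t)‖ₑ ^ 2 < M :=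
      frequently_lt_of_liminf_lt (by isBoundedDefault) hM1
    refine mem_domain_of_frequently_norm_yosidaOp_le hA hA0 hlpos hl1 (M := √M)
      (hfr.mono fun n hn => ?_)
    refine Real.le_sqrt_of_sq_le ?_
    have : (‖yosidaOp A (l n) (V t)‖₊ ^ 2 : NNReal) < M := by
      rw [← ENNReal.coe_lt_coe, ENNReal.coe_pow]
      exact hn
    exact_mod_cast this.le
  have hlim : ∀ᵐ t ∂(timeMeasure T),
      Tendsto (fun n => yosidaOp A (l n) (V t)) atTop (𝓝 (opApply A (V t))) := by
    filter_upwards [hdom] with t ht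
    refine ((tendsto_resolventOp hA hA0 (opApply A (V t))).comp hl0).congr fun n => ?_
    rw [Function.comp_apply, ← opApply_resolventOp hA hA0 (hlpos n),
      (isResolvent_resolventOp hA hA0 (hlpos n)).opApply_comm hA0 (hlpos n) ht]
  refine ⟨hdom, aestronglyMeasurable_of_tendsto_ae atTop hYm hlim, ?_⟩
  have hsq : eLpNorm (fun t => opApply A (V t)) 2 (timeMeasure T) ^ 2 ≤ K := by
    rw [eLpNorm_two_sq]
    refine le_trans (le_of_eq (lintegral_congr_ae ?_)) hfatou
    filter_upwards [hlim] with t ht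
    exact (((ENNReal.continuous_pow 2).tendsto _).comp
      ((continuous_enorm.tendsto _).comp ht)).liminf_eq.symm
  by_contra htop
  rw [not_lt, top_le_iff] at htop
  rw [htop] at hsq
  simp only [ne_eq, OfNat.ofNat_ne_zero, not_false_eq_true, ENNReal.top_pow, top_le_iff] at hsq
  exact hKtop.ne hsq

lemma mildSolution_eq_add_integral (hE : E.IsGenerator (-A)) (hEa : E.IsBoundedAnalytic)
    (hEc : E.IsContraction) (hA : IsSelfAdjoint A) (hA0 : IsNonnegOp A) {S : H →ₗ.[ℂ] H}
    (hS : IsNonnegSqrt A S) {V₀ : H} (hV₀ : V₀ ∈ S.domain) (hF : MemLp F 2 (timeMeasure T))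
    {t : ℝ} (ht : t ∈ timeInterval T) :
    E.mildSolution F V₀ t =
      V₀ + ∫ τ in (0 : ℝ)..t, (F τ - opApply A (E.mildSolution F V₀ τ)) := by
  have hl0 : Tendsto (fun n : ℕ => (1 / ((n : ℝ) + 1))) atTop (𝓝[>] 0) :=
    tendsto_nhdsWithin_iff.2 ⟨tendsto_one_div_add_atTop_nhds_zero_nat,
      Eventually.of_forall fun n => mem_Ioi.2 (by positivity)⟩
  set l : ℕ → ℝ := fun n => 1 / ((n : ℝ) + 1) with hl
  have hlpos : ∀ n, 0 < l n := fun n => by simp only [hl]; positivity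
  obtain ⟨hdom, hAV⟩ := mildSolution_mem_domain hE hEa hEc hA hA0 hS hV₀ hF
  set V := E.mildSolution F V₀
  have hG : MemLp (fun τ => F τ - opApply A (V τ)) 2 (timeMeasure T) := hF.sub hAV
  have hGi := MemLp.intervalIntegrable_of_mem hG ht
  have hlim1 := (tendsto_resolventOp hA hA0 (V t)).comp hl0
  have hlim2 : Tendsto (fun n => resolventOp A (l n) V₀ +
      ∫ τ in (0 : ℝ)..t, resolventOp A (l n) (F τ - opApply A (V τ))) atTop
      (𝓝 (V₀ + ∫ τ in (0 : ℝ)..t, (F τ - opApply A (V τ)))) := by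
    refine ((tendsto_resolventOp hA hA0 V₀).comp hl0).add ?_
    refine intervalIntegral.tendsto_integral_filter_of_dominated_convergence
      (fun τ => ‖F τ - opApply A (V τ)‖) ?_ ?_ hGi.norm ?_
    · exact Eventually.of_forall fun n =>
        (resolventOp A (l n)).continuous.comp_aestronglyMeasurable
          hGi.aestronglyMeasurable_restrict_uIoc
    · exact Eventually.of_forall fun n => Eventually.of_forall fun τ _ =>
        (isResolvent_resolventOp hA hA0 (hlpos n)).norm_apply_le hA0 (hlpos n) _
    · exact Eventually.of_forall fun τ _ => (tendsto_resolventOp hA hA0 _).comp hl0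
  refine tendsto_nhds_unique hlim1 (hlim2.congr fun n => ?_)
  rw [Function.comp_apply, resolventOp_mildSolution hE hEa hEc hA hA0 (hlpos n) ht.1.le
    (MemLp.intervalIntegrable_of_mem hF ht)]
  congr 1
  rw [intervalIntegral.integral_of_le ht.1.le, intervalIntegral.integral_of_le ht.1.le]
  refine integral_congr_ae ?_
  filter_upwards [hdom.filter_mono (ae_mono (restrict_Ioc_le_timeMeasure ht))] with τ hτ
  rw [map_sub, ← (isResolvent_resolventOp hA hA0 (hlpos n)).opApply_comm hA0 (hlpos n) hτ,
    opApply_resolventOp hA hA0 (hlpos n)]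

/-- Maximal regularity of the mild solution of `V' + A V = F`, `V(0) = V₀ ∈ D(A^{1/2})`. -/
lemma mildSolution_regularity (hE : E.IsGenerator (-A)) (hEa : E.IsBoundedAnalytic)
    (hEc : E.IsContraction) (hA : IsSelfAdjoint A) (hA0 : IsNonnegOp A) {S : H →ₗ.[ℂ] H}
    (hS : IsNonnegSqrt A S) {V₀ : H} (hV₀ : V₀ ∈ S.domain) (hT : 0 < T)
    (hF : MemLp F 2 (timeMeasure T)) :
    HasL2Regularity A T (E.mildSolution F V₀) ∧
      IsTimeDeriv T (E.mildSolution F V₀) (fun t => F t - opApply A (E.mildSolution F V₀ t)) ∧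
      Tendsto (E.mildSolution F V₀) (𝓝[>] 0) (𝓝 V₀) := by
  obtain ⟨hdom, hAV⟩ := mildSolution_mem_domain hE hEa hEc hA hA0 hS hV₀ hF
  have heq := fun {t} (ht : t ∈ timeInterval T) =>
    mildSolution_eq_add_integral hE hEa hEc hA hA0 hS hV₀ hF ht
  set V := E.mildSolution F V₀
  have hG : MemLp (fun τ => F τ - opApply A (V τ)) 2 (timeMeasure T) := hF.sub hAV
  have hderiv : IsTimeDeriv T V (fun t => F t - opApply A (V t)) := by
    refine ⟨MemLp.locallyIntegrableOn_timeInterval hG, fun s hs t ht => ?_⟩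
    rw [heq ht, heq hs, add_sub_add_left_eq_sub, intervalIntegral.integral_interval_sub_left
      (MemLp.intervalIntegrable_of_mem hG ht) (MemLp.intervalIntegrable_of_mem hG hs)]
  refine ⟨⟨hderiv.continuousOn, ⟨_, hderiv⟩, (memLp_congr_ae hderiv.timeDeriv_ae_eq).2 hG, hdom,
    hAV⟩, hderiv, ?_⟩
  obtain ⟨q, hq0, hqT⟩ := EReal.lt_iff_exists_rat_btwn.1 hT
  have hq : (q : ℝ) ∈ timeInterval T := ⟨EReal.coe_lt_coe_iff.1 hq0, hqT⟩
  have hc := intervalIntegral.continuousOn_primitive_interval'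
    (MemLp.intervalIntegrable_of_mem hG hq) left_mem_uIcc
  have h2 := hc 0 left_mem_uIcc
  rw [ContinuousWithinAt, intervalIntegral.integral_same] at h2
  have h3 : uIcc 0 (q : ℝ) ∈ 𝓝[>] 0 := by
    rw [uIcc_of_le hq.1.le]
    exact mem_of_superset (Ioo_mem_nhdsGT hq.1) Ioo_subset_Icc_self
  have h4 := (h2.mono_left (nhdsWithin_le_of_mem h3)).const_add V₀
  rw [add_zero] at h4
  refine h4.congr' ?_
  filter_upwards [Ioo_mem_nhdsGT hq.1] with t ht
  exact (heq (timeInterval_mono_right hq ht.1 ht.2.le)).symm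

end C0Semigroup

/-! ### The perturbation -/

section

variable [CompleteSpace H] {A : H →ₗ.[ℂ] H} {B : ℝ → H →ₗ.[ℂ] H} {S T : EReal} {C₁ C₂ : ℝ}

/-- The operators `B(t) (1 + A)⁻¹` are bounded and norm continuous in `t`. -/
lemma exists_perturbation_resolvent (hA : IsSelfAdjoint A) (hA0 : IsNonnegOp A)
    (hdom : ∀ t : ℝ, 0 ≤ t → (t : EReal) < T → A.domain ≤ (B t).domain) (hC₁ : 0 < C₁)
    (hB : RelativelyBounded A B T C₁ C₂) (hBt : TimeRegular A B T) :
    ∃ K : ℝ → H →L[ℂ] H, ContinuousOn K (timeInterval T) ∧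
      ∀ t ∈ timeInterval T, ∀ f, K t f = opApply (B t) (resolventOp A 1 f) := by
  have hJ := isResolvent_resolventOp hA hA0 one_pos
  set J := resolventOp A 1
  have hJn : ∀ f, ‖J f‖ ≤ ‖f‖ := hJ.norm_apply_le hA0 one_pos
  have hAJ : ∀ f, ‖opApply A (J f)‖ ≤ 2 * ‖f‖ := by
    intro f
    have h := hJ.opApply_eq one_pos f
    rw [Complex.ofReal_one, inv_one, one_smul] at h
    rw [h]
    linarith [norm_sub_le f (J f), hJn f]
  have hex : ∀ t : ℝ, ∃ K : H →L[ℂ] H, t ∈ timeInterval T → ∀ f, K f = opApply (B t) (J f) := by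
    intro t
    by_cases ht : t ∈ timeInterval T
    · have hd := hdom t ht.1.le ht.2
      let L : H →ₗ[ℂ] H :=
        { toFun := fun f => opApply (B t) (J f)
          map_add' := fun f g => by
            rw [map_add, opApply_add (hd (hJ.mem f)) (hd (hJ.mem g))]
          map_smul' := fun c f => by
            rw [map_smul, opApply_smul c (hd (hJ.mem f)), RingHom.id_apply] }
      refine ⟨L.mkContinuous (2 * C₁ + |C₂|) fun f => ?_, fun _ f => rfl⟩
      refine (hB t ht.1.le ht.2 _ (hJ.mem f)).trans ?_
      have h1 := mul_le_mul_of_nonneg_left (hAJ f) hC₁.le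
      have h2 : C₂ * ‖J f‖ ≤ |C₂| * ‖f‖ :=
        (mul_le_mul_of_nonneg_right (le_abs_self C₂) (norm_nonneg _)).trans
          (mul_le_mul_of_nonneg_left (hJn f) (abs_nonneg _))
      linarith
    · exact ⟨0, fun h => absurd h ht⟩
  choose K hK using hex
  obtain ⟨C, hC, hreg⟩ := hBt
  have hlip : ∀ s ∈ timeInterval T, ∀ t ∈ timeInterval T, s ≤ t →
      ‖K t - K s‖ ≤ 3 * C * (t - s) := by
    intro s hs t ht hst
    have hts := sub_nonneg.2 hst
    refine ContinuousLinearMap.opNorm_le_bound _ (by positivity) fun f => ?_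
    have h := hreg (fun _ => J f) ⟨fun _ _ => hJ.mem f, continuousOn_const, continuousOn_const⟩
      s t hs.1 hst ht.2
    simp only [sub_self, norm_zero, add_zero, mul_zero] at h
    rw [_root_.sub_apply, hK t ht, hK s hs]
    refine h.trans ?_
    have h2 : ‖opApply A (J f)‖ + ‖J f‖ ≤ 3 * ‖f‖ := by linarith [hAJ f, hJn f]
    have h3 := mul_le_mul_of_nonneg_left h2 (mul_nonneg hC.le hts)
    linarith
  refine ⟨K, LipschitzOnWith.continuousOn (K := (3 * C).toNNReal)
    (LipschitzOnWith.of_dist_le_mul fun s hs t ht => ?_), hK⟩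
  rw [Real.coe_toNNReal _ (by positivity)]
  rcases le_total s t with h | h
  · rw [dist_comm, dist_eq_norm, dist_comm, Real.dist_eq, abs_of_nonneg (sub_nonneg.2 h)]
    exact hlip s hs t ht h
  · rw [dist_eq_norm, Real.dist_eq, abs_of_nonneg (sub_nonneg.2 h)]
    exact hlip t ht s hs h

lemma aestronglyMeasurable_perturbation (hA : IsSelfAdjoint A) (hA0 : IsNonnegOp A)
    (hdom : ∀ t : ℝ, 0 ≤ t → (t : EReal) < T → A.domain ≤ (B t).domain) (hC₁ : 0 < C₁)
    (hB : RelativelyBounded A B T C₁ C₂) (hBt : TimeRegular A B T) (hST : S ≤ T) {φ : ℝ → H}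
    (hφ : HasL2Regularity A S φ) :
    AEStronglyMeasurable (fun t => opApply (B t) (φ t)) (timeMeasure S) := by
  obtain ⟨K, hKc, hK⟩ := exists_perturbation_resolvent hA hA0 hdom hC₁ hB hBt
  have hKm : AEStronglyMeasurable K (timeMeasure S) :=
    (hKc.mono (timeInterval_subset hST)).aestronglyMeasurable (measurableSet_timeInterval S)
  have hφm : AEStronglyMeasurable φ (timeMeasure S) :=
    hφ.continuousOn.aestronglyMeasurable (measurableSet_timeInterval S)
  refine ((ContinuousLinearMap.id ℂ (H →L[ℂ] H)).aestronglyMeasurable_comp₂ hKm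
    (hφm.add hφ.memLp_op.1)).congr ?_
  filter_upwards [hφ.mem_domain, ae_restrict_mem (measurableSet_timeInterval S)] with t ht htS
  rw [ContinuousLinearMap.id_apply, hK t (timeInterval_subset hST htS), Pi.add_apply]
  congr 1
  refine (isResolvent_resolventOp hA hA0 one_pos).eq_of_add_smul hA0 one_pos ht ?_
  rw [Complex.ofReal_one, one_smul]

lemma eLpNorm_perturbation_le (hC₁ : 0 < C₁) (hC₂ : 0 ≤ C₂) (hB : RelativelyBounded A B T C₁ C₂)
    (hST : S ≤ T) {φ : ℝ → H} (hφ : HasL2Regularity A S φ) :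
    eLpNorm (fun t => opApply (B t) (φ t)) 2 (timeMeasure S) ≤
      ENNReal.ofReal C₁ * eLpNorm (fun t => opApply A (φ t)) 2 (timeMeasure S) +
        ENNReal.ofReal C₂ * eLpNorm φ 2 (timeMeasure S) := by
  have hφm : AEStronglyMeasurable φ (timeMeasure S) :=
    hφ.continuousOn.aestronglyMeasurable (measurableSet_timeInterval S)
  have h1 : eLpNorm (fun t => opApply (B t) (φ t)) 2 (timeMeasure S) ≤
      eLpNorm ((C₁ • fun t => ‖opApply A (φ t)‖) + (C₂ • fun t => ‖φ t‖)) 2 (timeMeasure S) := by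
    refine eLpNorm_mono_ae_real ?_
    filter_upwards [hφ.mem_domain, ae_restrict_mem (measurableSet_timeInterval S)] with t ht htS
    exact hB t htS.1.le (timeInterval_subset hST htS).2 _ ht
  refine h1.trans ((eLpNorm_add_le (hφ.memLp_op.1.norm.const_smul C₁) (hφm.norm.const_smul C₂)
    one_le_two).trans_eq ?_)
  rw [eLpNorm_const_smul, eLpNorm_const_smul, eLpNorm_norm, eLpNorm_norm,
    Real.enorm_eq_ofReal hC₁.le, Real.enorm_eq_ofReal hC₂]

lemma HasL2Regularity.sub {φ φ' : ℝ → H} (h : HasL2Regularity A S φ)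
    (h' : HasL2Regularity A S φ') :
    HasL2Regularity A S (fun t => φ t - φ' t) ∧
      (timeDeriv S (fun t => φ t - φ' t) =ᵐ[timeMeasure S]
        fun t => timeDeriv S φ t - timeDeriv S φ' t) := by
  have hd := (timeDeriv_spec h.differentiable).sub (timeDeriv_spec h'.differentiable)
  have hae := hd.timeDeriv_ae_eq
  refine ⟨⟨h.continuousOn.sub h'.continuousOn, ⟨_, hd⟩,
    (memLp_congr_ae hae).2 (h.memLp_deriv.sub h'.memLp_deriv), ?_, ?_⟩, hae⟩
  · filter_upwards [h.mem_domain, h'.mem_domain] with t h1 h2 using A.domain.sub_mem h1 h2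
  · refine (memLp_congr_ae ?_).2 (h.memLp_op.sub h'.memLp_op)
    filter_upwards [h.mem_domain, h'.mem_domain] with t h1 h2 using opApply_sub h1 h2

/-! ### The weighted supremum -/

/-- `sup_{0<t<S} e^{-t} ‖φ(t)‖`. -/
def weightedSup (S : EReal) (φ : ℝ → H) : ENNReal :=
  ⨆ t ∈ timeInterval S, ENNReal.ofReal (Real.exp (-t)) * ‖φ t‖ₑ

lemma exp_neg_mul_sqrt_le_one {t : ℝ} (ht : 0 ≤ t) : Real.exp (-t) * √t ≤ 1 := by
  have h1 : √t ≤ Real.exp t := by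
    rw [Real.sqrt_le_left (Real.exp_pos t).le]
    have h2 := Real.add_one_le_exp t
    nlinarith
  calc _ ≤ Real.exp (-t) * Real.exp t := by gcongr
    _ = 1 := by rw [← Real.exp_add, neg_add_cancel, Real.exp_zero]

lemma exp_neg_mul_lintegral_le {g : ℝ → H} (hg : MemLp g 2 (timeMeasure S)) {t : ℝ}
    (ht : t ∈ timeInterval S) :
    ENNReal.ofReal (Real.exp (-t)) * ∫⁻ τ in Ioc 0 t, ‖g τ‖ₑ ≤ eLpNorm g 2 (timeMeasure S) := by
  have hle := restrict_Ioc_le_timeMeasure ht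
  have h1 := eLpNorm_le_eLpNorm_mul_rpow_measure_univ (p := 1) (q := 2) one_le_two
    (hg.1.mono_measure hle)
  rw [eLpNorm_one_eq_lintegral_enorm, Measure.restrict_apply_univ, Real.volume_Ioc, sub_zero] at h1
  have h2 : ENNReal.ofReal t ^ (1 / (1 : ENNReal).toReal - 1 / (2 : ENNReal).toReal) =
      ENNReal.ofReal √t := by
    rw [ENNReal.ofReal_rpow_of_nonneg ht.1.le (by norm_num), Real.sqrt_eq_rpow]
    norm_num
  rw [h2] at h1
  calc _ ≤ ENNReal.ofReal (Real.exp (-t)) *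
        (eLpNorm g 2 (volume.restrict (Ioc 0 t)) * ENNReal.ofReal √t) := by gcongr
    _ = ENNReal.ofReal (Real.exp (-t) * √t) * eLpNorm g 2 (volume.restrict (Ioc 0 t)) := by
      rw [ENNReal.ofReal_mul (Real.exp_pos _).le]
      ring
    _ ≤ 1 * eLpNorm g 2 (timeMeasure S) := by
      gcongr
      exact ENNReal.ofReal_le_one.2 (exp_neg_mul_sqrt_le_one ht.1.le)
    _ = _ := one_mul _

lemma weightedSup_le {g φ : ℝ → H} {c : ENNReal} (hg : MemLp g 2 (timeMeasure S))
    (h : ∀ t ∈ timeInterval S, ‖φ t‖ₑ ≤ c + ∫⁻ τ in Ioc 0 t, ‖g τ‖ₑ) :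
    weightedSup S φ ≤ c + eLpNorm g 2 (timeMeasure S) := by
  refine iSup₂_le fun t ht => ?_
  calc _ ≤ ENNReal.ofReal (Real.exp (-t)) * (c + ∫⁻ τ in Ioc 0 t, ‖g τ‖ₑ) := by
        gcongr
        exact h t ht
    _ = ENNReal.ofReal (Real.exp (-t)) * c +
        ENNReal.ofReal (Real.exp (-t)) * ∫⁻ τ in Ioc 0 t, ‖g τ‖ₑ := mul_add _ _ _
    _ ≤ 1 * c + eLpNorm g 2 (timeMeasure S) := by
      gcongr
      · exact ENNReal.ofReal_le_one.2 (Real.exp_le_one_iff.2 (neg_nonpos.2 ht.1.le))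
      · exact exp_neg_mul_lintegral_le hg ht
    _ = _ := by rw [one_mul]

lemma eq_zero_of_weightedSup_eq_zero {φ : ℝ → H} (h : weightedSup S φ = 0) {t : ℝ}
    (ht : t ∈ timeInterval S) : φ t = 0 := by
  have h1 : ENNReal.ofReal (Real.exp (-t)) * ‖φ t‖ₑ ≤ 0 :=
    (le_iSup₂ (f := fun t (_ : t ∈ timeInterval S) => ENNReal.ofReal (Real.exp (-t)) * ‖φ t‖ₑ)
      t ht).trans_eq h
  rcases mul_eq_zero.1 (le_antisymm h1 zero_le) with h2 | h2
  · exact absurd (ENNReal.ofReal_eq_zero.1 h2) (not_le.2 (Real.exp_pos _))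
  · exact enorm_eq_zero.1 h2

lemma enorm_le_exp_mul_weightedSup (φ : ℝ → H) {t : ℝ} (ht : t ∈ timeInterval S) :
    ‖φ t‖ₑ ≤ ENNReal.ofReal (Real.exp t) * weightedSup S φ := by
  have h1 : ENNReal.ofReal (Real.exp (-t)) * ‖φ t‖ₑ ≤ weightedSup S φ :=
    le_iSup₂ (f := fun t (_ : t ∈ timeInterval S) => ENNReal.ofReal (Real.exp (-t)) * ‖φ t‖ₑ) t ht
  calc ‖φ t‖ₑ = ENNReal.ofReal (Real.exp t) * (ENNReal.ofReal (Real.exp (-t)) * ‖φ t‖ₑ) := by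
        rw [← mul_assoc, ← ENNReal.ofReal_mul (Real.exp_pos _).le, ← Real.exp_add, add_neg_cancel,
          Real.exp_zero, ENNReal.ofReal_one, one_mul]
    _ ≤ _ := by gcongr

lemma eLpNorm_le_sqrt_mul_weightedSup (φ : ℝ → H) {s : ℝ} (hs : 0 ≤ s) :
    eLpNorm φ 2 (timeMeasure s) ≤
      ENNReal.ofReal √((Real.exp (2 * s) - 1) / 2) * weightedSup (s : EReal) φ := by
  have hTI : timeInterval (s : EReal) = Ioo 0 s := by
    ext t
    simp [timeInterval, EReal.coe_lt_coe_iff]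
  have hexp : 0 ≤ (Real.exp (2 * s) - 1) / 2 := by
    have := Real.add_one_le_exp (2 * s)
    linarith
  have hint : ∫⁻ t in Ioo 0 s, ENNReal.ofReal (Real.exp (2 * t)) =
      ENNReal.ofReal ((Real.exp (2 * s) - 1) / 2) := by
    rw [restrict_Ioo_eq_restrict_Ioc, ← ofReal_integral_eq_lintegral_ofReal,
      ← intervalIntegral.integral_of_le hs]
    · congr 1
      rw [intervalIntegral.integral_comp_mul_left (fun x => Real.exp x) two_ne_zero, integral_exp]
      simp
      ring
    · exact ((by fun_prop : Continuous fun t : ℝ => Real.exp (2 * t)).intervalIntegrable 0 s).1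
    · exact Eventually.of_forall fun t => (Real.exp_pos _).le
  have hsq : eLpNorm φ 2 (timeMeasure s) ^ 2 ≤
      (ENNReal.ofReal √((Real.exp (2 * s) - 1) / 2) * weightedSup (s : EReal) φ) ^ 2 := by
    rw [eLpNorm_two_sq, mul_pow, ← ENNReal.ofReal_pow (Real.sqrt_nonneg _), Real.sq_sqrt hexp,
      ← hint, timeMeasure, ← lintegral_mul_const _ (by fun_prop), hTI]
    refine setLIntegral_mono' measurableSet_Ioo fun t ht => ?_
    have h := enorm_le_exp_mul_weightedSup φ (hTI.symm ▸ ht : t ∈ timeInterval (s : EReal))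
    calc ‖φ t‖ₑ ^ 2 ≤ (ENNReal.ofReal (Real.exp t) * weightedSup (s : EReal) φ) ^ 2 := by gcongr
      _ = _ := by
        rw [mul_pow, ← ENNReal.ofReal_pow (Real.exp_pos _).le, ← Real.exp_nat_mul, Nat.cast_two]
  exact (ENNReal.pow_le_pow_left_iff two_ne_zero).1 hsq

end

/-! ### Well-posedness of the perturbed problem -/

lemma toReal_le_of_le_ofReal_mul_add {x y z : ENNReal} {a b : ℝ} (ha : 0 ≤ a) (hb : 0 ≤ b)
    (hy : y ≠ ⊤) (hz : z ≠ ⊤) (h : x ≤ ENNReal.ofReal a * y + ENNReal.ofReal b * z) :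
    x.toReal ≤ a * y.toReal + b * z.toReal := by
  have h1 : ENNReal.ofReal a * y ≠ ⊤ := ENNReal.mul_ne_top ENNReal.ofReal_ne_top hy
  have h2 : ENNReal.ofReal b * z ≠ ⊤ := ENNReal.mul_ne_top ENNReal.ofReal_ne_top hz
  refine (ENNReal.toReal_mono (ENNReal.add_ne_top.2 ⟨h1, h2⟩) h).trans_eq ?_
  rw [ENNReal.toReal_add h1 h2, ENNReal.toReal_mul, ENNReal.toReal_mul, ENNReal.toReal_ofReal ha,
    ENNReal.toReal_ofReal hb]

section

variable [CompleteSpace H] {A : H →ₗ.[ℂ] H} {B : ℝ → H →ₗ.[ℂ] H} {E : C0Semigroup H}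
  {S T : EReal} {C₁ C₂ CA q : ℝ} {F G : ℝ → H}

lemma weightedSup_mildSolution_le (hEc : E.IsContraction) (hF : MemLp F 2 (timeMeasure S))
    (V₀ : H) : weightedSup S (E.mildSolution F V₀) ≤ ‖V₀‖ₑ + eLpNorm F 2 (timeMeasure S) := by
  refine weightedSup_le hF fun t ht => ?_
  have hi := MemLp.intervalIntegrable_of_mem hF ht
  have h := ENNReal.ofReal_le_ofReal (C0Semigroup.norm_mildSolution_le hEc ht.1.le hi V₀)
  rw [ENNReal.ofReal_add (norm_nonneg _)
    (intervalIntegral.integral_nonneg ht.1.le fun _ _ => norm_nonneg _), ofReal_norm, ofReal_norm,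
    intervalIntegral.integral_of_le ht.1.le, ofReal_integral_norm_eq_lintegral_enorm
      ((intervalIntegrable_iff_integrableOn_Ioc_of_le ht.1.le).1 hi)] at h
  exact h

lemma mildSolution_sub_mildSolution (hEa : E.IsBoundedAnalytic) (hEc : E.IsContraction)
    (hF : MemLp F 2 (timeMeasure S)) (hG : MemLp G 2 (timeMeasure S)) (V₀ : H) {t : ℝ}
    (ht : t ∈ timeInterval S) :
    E.mildSolution F V₀ t - E.mildSolution G V₀ t =
      E.mildSolution (fun τ => F τ - G τ) 0 t := by
  simp only [C0Semigroup.mildSolution, map_sub, map_zero, zero_add, add_sub_add_left_eq_sub]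
  exact (intervalIntegral.integral_sub
    (C0Semigroup.intervalIntegrable_apply_sub hEa hEc ht.1.le
      (MemLp.intervalIntegrable_of_mem hF ht))
    (C0Semigroup.intervalIntegrable_apply_sub hEa hEc ht.1.le
      (MemLp.intervalIntegrable_of_mem hG ht))).symm

lemma maxReg_mildSolution (hA : IsSelfAdjoint A) (hA0 : IsNonnegOp A)
    (hE : E.IsGenerator (-A)) (hEc : E.IsContraction) (hEa : E.IsBoundedAnalytic)
    (hCA : IsMaxRegConst A CA) (hS0 : 0 < S) (hF : MemLp F 2 (timeMeasure S))
    (V₀ : (opSqrt A).domain) :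
    eLpNorm (timeDeriv S (E.mildSolution F V₀)) 2 (timeMeasure S) +
        eLpNorm (fun t => opApply A (E.mildSolution F V₀ t)) 2 (timeMeasure S) ≤
      ENNReal.ofReal (√2 * ‖opSqrt A V₀‖) + ENNReal.ofReal CA * eLpNorm F 2 (timeMeasure S) := by
  obtain ⟨h1, h2, h3⟩ := C0Semigroup.mildSolution_regularity hE hEa hEc hA hA0
    (isNonnegSqrt_opSqrt hA hA0) V₀.2 hS0 hF
  refine hCA.2 S hS0 F hF V₀ _ h1 ?_ h3
  filter_upwards [h2.timeDeriv_ae_eq] with t ht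
  rw [ht, sub_add_cancel]

lemma eLpNorm_perturbation_le_weightedSup (hC₁ : 0 < C₁) (hC₂ : 0 ≤ C₂)
    (hB : RelativelyBounded A B T C₁ C₂) (hST : S ≤ T)
    (hq : ∀ φ : ℝ → H, ENNReal.ofReal C₂ * eLpNorm φ 2 (timeMeasure S) ≤
      ENNReal.ofReal q * weightedSup S φ) {φ : ℝ → H} (hφ : HasL2Regularity A S φ) :
    eLpNorm (fun t => opApply (B t) (φ t)) 2 (timeMeasure S) ≤
      ENNReal.ofReal C₁ * eLpNorm (fun t => opApply A (φ t)) 2 (timeMeasure S) +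
        ENNReal.ofReal q * weightedSup S φ :=
  (eLpNorm_perturbation_le hC₁ hC₂ hB hST hφ).trans (add_le_add_right (hq φ) _)

lemma memLp_perturbation (hA : IsSelfAdjoint A) (hA0 : IsNonnegOp A)
    (hdom : ∀ t : ℝ, 0 ≤ t → (t : EReal) < T → A.domain ≤ (B t).domain) (hC₁ : 0 < C₁)
    (hC₂ : 0 ≤ C₂) (hB : RelativelyBounded A B T C₁ C₂) (hBt : TimeRegular A B T) (hST : S ≤ T)
    (hq : ∀ φ : ℝ → H, ENNReal.ofReal C₂ * eLpNorm φ 2 (timeMeasure S) ≤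
      ENNReal.ofReal q * weightedSup S φ) {φ : ℝ → H} (hφ : HasL2Regularity A S φ)
    (hsup : weightedSup S φ < ⊤) :
    MemLp (fun t => opApply (B t) (φ t)) 2 (timeMeasure S) :=
  ⟨aestronglyMeasurable_perturbation hA hA0 hdom hC₁ hB hBt hST hφ,
    (eLpNorm_perturbation_le_weightedSup hC₁ hC₂ hB hST hq hφ).trans_lt
      (ENNReal.add_lt_top.2 ⟨ENNReal.mul_lt_top ENNReal.ofReal_lt_top hφ.memLp_op.2,
        ENNReal.mul_lt_top ENNReal.ofReal_lt_top hsup⟩)⟩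

lemma perturbation_sub_ae
    (hdom : ∀ t : ℝ, 0 ≤ t → (t : EReal) < T → A.domain ≤ (B t).domain) (hST : S ≤ T)
    {φ ψ : ℝ → H} (hφ : HasL2Regularity A S φ) (hψ : HasL2Regularity A S ψ) :
    ∀ᵐ t ∂(timeMeasure S),
      opApply (B t) (φ t - ψ t) = opApply (B t) (φ t) - opApply (B t) (ψ t) := by
  filter_upwards [hφ.mem_domain, hψ.mem_domain, ae_restrict_mem (measurableSet_timeInterval S)]
    with t h1 h2 htS
  have hd := hdom t htS.1.le (timeInterval_subset hST htS).2
  exact opApply_sub (hd h1) (hd h2)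

/-- The contraction mapping principle for `F ↦ -B V_F`, with `V_F` the mild solution of
`V' + A V = F`, `V(0) = V₀`. -/
lemma exists_forcing (hA : IsSelfAdjoint A) (hA0 : IsNonnegOp A)
    (hE : E.IsGenerator (-A)) (hEc : E.IsContraction) (hEa : E.IsBoundedAnalytic)
    (hdom : ∀ t : ℝ, 0 ≤ t → (t : EReal) < T → A.domain ≤ (B t).domain) (hC₁ : 0 < C₁)
    (hC₂ : 0 ≤ C₂) (hB : RelativelyBounded A B T C₁ C₂) (hBt : TimeRegular A B T)
    (hS0 : 0 < S) (hST : S ≤ T) (hCA : IsMaxRegConst A CA) (hq0 : 0 ≤ q)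
    (hq : ∀ φ : ℝ → H, ENNReal.ofReal C₂ * eLpNorm φ 2 (timeMeasure S) ≤
      ENNReal.ofReal q * weightedSup S φ) (hlt : C₁ * CA + q < 1) (V₀ : (opSqrt A).domain) :
    ∃ F : ℝ → H, MemLp F 2 (timeMeasure S) ∧
      F =ᵐ[timeMeasure S] fun t => -opApply (B t) (E.mildSolution F V₀ t) := by
  have hreg := fun {F : ℝ → H} (hF : MemLp F 2 (timeMeasure S)) (V₀ : (opSqrt A).domain) =>
    (C0Semigroup.mildSolution_regularity hE hEa hEc hA hA0
      (isNonnegSqrt_opSqrt hA hA0) V₀.2 hS0 hF).1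
  have hmem : ∀ F : Lp H 2 (timeMeasure S),
      MemLp (fun t => -opApply (B t) (E.mildSolution F V₀ t)) 2 (timeMeasure S) := fun F =>
    (memLp_perturbation hA hA0 hdom hC₁ hC₂ hB hBt hST hq (hreg (Lp.memLp F) V₀)
      ((weightedSup_mildSolution_le hEc (Lp.memLp F) _).trans_lt
        (ENNReal.add_lt_top.2 ⟨enorm_lt_top, (Lp.memLp F).2⟩))).neg
  let Φ : Lp H 2 (timeMeasure S) → Lp H 2 (timeMeasure S) := fun F => (hmem F).toLp
  have hk0 : 0 ≤ C₁ * CA + q := add_nonneg (mul_nonneg hC₁.le hCA.1.le) hq0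
  have hcontr : ContractingWith (C₁ * CA + q).toNNReal Φ := by
    refine ⟨Real.toNNReal_lt_one.2 hlt, fun F G => ?_⟩
    set D : ℝ → H := fun t => F t - G t with hD
    have hDm : MemLp D 2 (timeMeasure S) := (Lp.memLp F).sub (Lp.memLp G)
    have hregD := hreg hDm (0 : (opSqrt A).domain)
    have hDe : edist F G = eLpNorm D 2 (timeMeasure S) := Lp.edist_def F G
    rw [Lp.edist_toLp_toLp, hDe]
    have hW : eLpNorm ((fun t => -opApply (B t) (E.mildSolution F V₀ t)) -
        fun t => -opApply (B t) (E.mildSolution G V₀ t)) 2 (timeMeasure S) =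
        eLpNorm (fun t => opApply (B t) (E.mildSolution D (0 : (opSqrt A).domain) t)) 2
          (timeMeasure S) := by
      refine eLpNorm_congr_enorm_ae ?_
      filter_upwards [perturbation_sub_ae hdom hST (hreg (Lp.memLp F) V₀) (hreg (Lp.memLp G) V₀),
        ae_restrict_mem (measurableSet_timeInterval S)] with t ht htS
      rw [ZeroMemClass.coe_zero, ← mildSolution_sub_mildSolution hEa hEc (Lp.memLp F) (Lp.memLp G)
        V₀ htS, ht, Pi.sub_apply, neg_sub_neg, enorm_sub_rev]
    rw [hW]
    refine (eLpNorm_perturbation_le_weightedSup hC₁ hC₂ hB hST hq hregD).trans ?_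
    have h1 := maxReg_mildSolution hA hA0 hE hEc hEa hCA hS0 hDm 0
    rw [LinearPMap.map_zero, norm_zero, mul_zero, ENNReal.ofReal_zero, zero_add] at h1
    have h2 := weightedSup_mildSolution_le hEc hDm ((0 : (opSqrt A).domain) : H)
    rw [ZeroMemClass.coe_zero, enorm_zero, zero_add] at h2
    calc _ ≤ ENNReal.ofReal C₁ * (ENNReal.ofReal CA * eLpNorm D 2 (timeMeasure S)) +
          ENNReal.ofReal q * eLpNorm D 2 (timeMeasure S) := by
          gcongr
          · exact le_add_self.trans h1
          · exact h2
      _ = ENNReal.ofReal (C₁ * CA + q) * eLpNorm D 2 (timeMeasure S) := by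
        rw [ENNReal.ofReal_add (mul_nonneg hC₁.le hCA.1.le) hq0, ENNReal.ofReal_mul hC₁.le]
        ring
      _ = _ := rfl
  obtain ⟨F, hF, -⟩ := hcontr.exists_fixedPoint 0 (edist_ne_top _ _)
  refine ⟨F, Lp.memLp F, ?_⟩
  have h : ((hmem F).toLp : ℝ → H) =ᵐ[timeMeasure S]
      fun t => -opApply (B t) (E.mildSolution F V₀ t) := (hmem F).coeFn_toLp
  have hF' : (hmem F).toLp = F := hF
  rw [hF'] at h
  exact h

lemma normY_eq (φ : ℝ → H) : normY A S φ = weightedSup S φ +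
    (eLpNorm (timeDeriv S φ) 2 (timeMeasure S) +
      eLpNorm (fun t => opApply A (φ t)) 2 (timeMeasure S)) :=
  add_assoc _ _ _

lemma IsStrongSolution.equation_add
    (hdom : ∀ t : ℝ, 0 ≤ t → (t : EReal) < T → A.domain ≤ (B t).domain) (hST : S ≤ T)
    {v₀ : H} {v : ℝ → H} (hv : IsStrongSolution A B S v₀ v) :
    ∀ᵐ t ∂(timeMeasure S),
      timeDeriv S v t + opApply A (v t) + opApply (B t) (v t) = 0 := by
  filter_upwards [hv.equation, hv.memY.1.mem_domain,
    ae_restrict_mem (measurableSet_timeInterval S)] with t h1 h2 htS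
  rw [opApply_addOp h2 (hdom t htS.1.le (timeInterval_subset hST htS).2 h2), ← add_assoc] at h1
  exact h1

/-- Uniqueness of strong solutions. -/
lemma IsStrongSolution.eqOn (hA : IsSelfAdjoint A) (hA0 : IsNonnegOp A)
    (hdom : ∀ t : ℝ, 0 ≤ t → (t : EReal) < T → A.domain ≤ (B t).domain) (hC₁ : 0 < C₁)
    (hC₂ : 0 ≤ C₂) (hB : RelativelyBounded A B T C₁ C₂) (hBt : TimeRegular A B T)
    (hS0 : 0 < S) (hST : S ≤ T) (hCA : IsMaxRegConst A CA) (hq0 : 0 ≤ q)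
    (hq : ∀ φ : ℝ → H, ENNReal.ofReal C₂ * eLpNorm φ 2 (timeMeasure S) ≤
      ENNReal.ofReal q * weightedSup S φ) (hlt : CA * (C₁ + q) < 1) {v₀ : H} {v w : ℝ → H}
    (hw : IsStrongSolution A B S v₀ w) (hv : IsStrongSolution A B S v₀ v) :
    EqOn w v (timeInterval S) := by
  obtain ⟨hd, hdt⟩ := hw.memY.1.sub hv.memY.1
  set d : ℝ → H := fun t => w t - v t with hdef
  have hd0 : Tendsto d (𝓝[>] 0) (𝓝 0) := by
    have := hw.initial.sub hv.initial
    rwa [sub_self] at this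
  have hD := timeDeriv_spec hd.differentiable
  have hsup : weightedSup S d ≤ eLpNorm (timeDeriv S d) 2 (timeMeasure S) := by
    have h := weightedSup_le (φ := d) (c := 0) hd.memLp_deriv fun t ht => by
      rw [hD.eq_add_integral hd.memLp_deriv hd0 ht, zero_add, zero_add,
        intervalIntegral.integral_of_le ht.1.le]
      exact enorm_integral_le_lintegral_enorm _
    rwa [zero_add] at h
  have hBd := memLp_perturbation hA hA0 hdom hC₁ hC₂ hB hBt hST hq hd
    (hsup.trans_lt hd.memLp_deriv.2)
  have hmax := hCA.2 S hS0 (fun t => -opApply (B t) (d t)) hBd.neg 0 d hd (by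
    filter_upwards [hdt, hw.equation_add hdom hST, hv.equation_add hdom hST,
      perturbation_sub_ae hdom hST hw.memY.1 hv.memY.1, hw.memY.1.mem_domain,
      hv.memY.1.mem_domain] with t h1 h2 h3 h4 h5 h6
    rw [h1, h4, opApply_sub h5 h6, ← sub_eq_zero, ← sub_eq_zero.2 (h2.trans h3.symm)]
    abel) (by simpa using hd0)
  have hneg : eLpNorm (fun t => -opApply (B t) (d t)) 2 (timeMeasure S) =
      eLpNorm (fun t => opApply (B t) (d t)) 2 (timeMeasure S) :=
    eLpNorm_neg (fun t => opApply (B t) (d t)) 2 _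
  rw [LinearPMap.map_zero, norm_zero, mul_zero, ENNReal.ofReal_zero, zero_add, hneg] at hmax
  have hest := eLpNorm_perturbation_le_weightedSup hC₁ hC₂ hB hST hq hd
  set X := eLpNorm (timeDeriv S d) 2 (timeMeasure S) +
    eLpNorm (fun t => opApply A (d t)) 2 (timeMeasure S) with hX
  have hXtop : X ≠ ⊤ := (ENNReal.add_lt_top.2 ⟨hd.memLp_deriv.2, hd.memLp_op.2⟩).ne
  have hest' : eLpNorm (fun t => opApply (B t) (d t)) 2 (timeMeasure S) ≤
      ENNReal.ofReal C₁ * X + ENNReal.ofReal q * X := by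
    refine hest.trans ?_
    gcongr
    · exact le_add_self
    · exact hsup.trans le_self_add
  have r1 := toReal_le_of_le_ofReal_mul_add (y := 0) (a := 0) le_rfl hCA.1.le ENNReal.zero_ne_top
    hBd.2.ne (hmax.trans le_add_self)
  have r2 := toReal_le_of_le_ofReal_mul_add hC₁.le hq0 hXtop hXtop hest'
  have hX0 : X = 0 := by
    have h0 : X.toReal ≤ CA * (C₁ + q) * X.toReal := by
      have := mul_le_mul_of_nonneg_left r2 hCA.1.le
      linarith
    have h1 : X.toReal = 0 := by
      by_contra hne
      have hpos : 0 < X.toReal := lt_of_le_of_ne ENNReal.toReal_nonneg (Ne.symm hne)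
      nlinarith
    exact ((ENNReal.toReal_eq_zero_iff X).1 h1).resolve_right hXtop
  have hsup0 : weightedSup S d = 0 :=
    le_antisymm (hsup.trans (le_self_add.trans hX0.le)) zero_le
  exact fun t ht => sub_eq_zero.1 (eq_zero_of_weightedSup_eq_zero hsup0 ht)

/-- Well-posedness on `(0, S)` when the lower order part of the perturbation is small. -/
lemma wellPosed_of_small (hA : IsSelfAdjoint A) (hA0 : IsNonnegOp A)
    (hE : E.IsGenerator (-A)) (hEc : E.IsContraction) (hEa : E.IsBoundedAnalytic)
    (hdom : ∀ t : ℝ, 0 ≤ t → (t : EReal) < T → A.domain ≤ (B t).domain) (hC₁ : 0 < C₁)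
    (hC₂ : 0 ≤ C₂) (hB : RelativelyBounded A B T C₁ C₂) (hBt : TimeRegular A B T)
    (hS0 : 0 < S) (hST : S ≤ T) (hCA : IsMaxRegConst A CA)
    (hsmall : C₁ * (CA + 1) < 1 / (4 * √2))
    (hq : ∀ φ : ℝ → H, ENNReal.ofReal C₂ * eLpNorm φ 2 (timeMeasure S) ≤
      ENNReal.ofReal (1 / (4 * √2) / (CA + 1)) * weightedSup S φ) (v₀ : (opSqrt A).domain) :
    ∃ v : ℝ → H, IsStrongSolution A B S v₀ v ∧
      (∀ w : ℝ → H, IsStrongSolution A B S v₀ w → EqOn w v (timeInterval S)) ∧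
      normY A S v ≤ ENNReal.ofReal (2 * ‖(v₀ : H)‖ + 2 * √2 * ‖opSqrt A v₀‖) ∧
      SatisfiesDuhamel E B S v₀ v := by
  set κ : ℝ := 1 / (4 * √2) with hκ
  have hκ0 : 0 < κ := by positivity
  have hκ1 : κ ≤ 1 / 4 := by
    rw [hκ]
    have : 1 ≤ √2 := Real.one_le_sqrt.2 one_le_two
    exact one_div_le_one_div_of_le (by norm_num) (by linarith)
  have hCA0 := hCA.1
  set q : ℝ := κ / (CA + 1) with hqdef
  have hq0 : 0 ≤ q := by positivity
  have hqCA : q * (CA + 1) = κ := div_mul_cancel₀ _ (by positivity)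
  obtain ⟨F, hF, hFB⟩ := exists_forcing hA hA0 hE hEc hEa hdom hC₁ hC₂ hB hBt hS0 hST hCA hq0 hq
    (by nlinarith) v₀
  obtain ⟨hreg, hderiv, hinit⟩ := C0Semigroup.mildSolution_regularity hE hEa hEc hA hA0
    (isNonnegSqrt_opSqrt hA hA0) v₀.2 hS0 hF
  have hmax := maxReg_mildSolution hA hA0 hE hEc hEa hCA hS0 hF v₀
  have hsup := weightedSup_mildSolution_le hEc hF (v₀ : H)
  have hest := eLpNorm_perturbation_le_weightedSup hC₁ hC₂ hB hST hq hreg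
  set v := E.mildSolution F v₀ with hv
  have hnF : eLpNorm F 2 (timeMeasure S) =
      eLpNorm (fun t => opApply (B t) (v t)) 2 (timeMeasure S) := by
    rw [eLpNorm_congr_ae hFB]
    exact eLpNorm_neg (fun t => opApply (B t) (v t)) 2 _
  set X := eLpNorm (timeDeriv S v) 2 (timeMeasure S) +
    eLpNorm (fun t => opApply A (v t)) 2 (timeMeasure S) with hX
  have hXtop : X ≠ ⊤ := (ENNReal.add_lt_top.2 ⟨hreg.memLp_deriv.2, hreg.memLp_op.2⟩).ne
  have hsuptop : weightedSup S v ≠ ⊤ :=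
    (hsup.trans_lt (ENNReal.add_lt_top.2 ⟨enorm_lt_top, hF.2⟩)).ne
  have hbound : normY A S v ≤ ENNReal.ofReal (2 * ‖(v₀ : H)‖ + 2 * √2 * ‖opSqrt A v₀‖) := by
    have r1 := toReal_le_of_le_ofReal_mul_add (a := √2 * ‖opSqrt A v₀‖) (y := 1) (by positivity)
      hCA0.le ENNReal.one_ne_top hF.2.ne (hmax.trans_eq (by rw [mul_one]))
    have r2 := toReal_le_of_le_ofReal_mul_add (a := 1) (b := 1) (y := ‖(v₀ : H)‖ₑ)
      zero_le_one zero_le_one enorm_ne_top hF.2.ne (hsup.trans_eq (by simp))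
    have r3 := toReal_le_of_le_ofReal_mul_add hC₁.le hq0 hXtop hsuptop
      (hnF.le.trans (hest.trans (by gcongr; exact le_add_self)))
    rw [toReal_enorm] at r2
    rw [normY_eq, ← hX, ← ENNReal.ofReal_toReal (ENNReal.add_ne_top.2 ⟨hsuptop, hXtop⟩)]
    refine ENNReal.ofReal_le_ofReal ?_
    rw [ENNReal.toReal_add hsuptop hXtop]
    simp only [ENNReal.toReal_one, mul_one, one_mul] at r1 r2
    set x := X.toReal
    set y := (weightedSup S v).toReal
    set f := (eLpNorm F 2 (timeMeasure S)).toReal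
    have hx : 0 ≤ x := ENNReal.toReal_nonneg
    have hy : 0 ≤ y := ENNReal.toReal_nonneg
    have r4 : (CA + 1) * f ≤ C₁ * (CA + 1) * x + κ * y := by
      have := mul_le_mul_of_nonneg_left r3 (show 0 ≤ CA + 1 by linarith)
      calc _ ≤ (CA + 1) * (C₁ * x + q * y) := this
        _ = C₁ * (CA + 1) * x + q * (CA + 1) * y := by ring
        _ = _ := by rw [hqCA]
    have r5 : C₁ * (CA + 1) * x ≤ 1 / 4 * x :=
      mul_le_mul_of_nonneg_right (hsmall.le.trans hκ1) hx
    have r6 : κ * y ≤ 1 / 4 * y := mul_le_mul_of_nonneg_right hκ1 hy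
    have r7 : 0 ≤ ‖(v₀ : H)‖ := norm_nonneg _
    have r8 : 0 ≤ √2 * ‖opSqrt A v₀‖ := by positivity
    linarith
  have hsol : IsStrongSolution A B S v₀ v := by
    refine ⟨⟨hreg, hbound.trans_lt ENNReal.ofReal_lt_top⟩, ?_, hinit⟩
    filter_upwards [hderiv.timeDeriv_ae_eq, hFB, hreg.mem_domain,
      ae_restrict_mem (measurableSet_timeInterval S)] with t h1 h2 h3 htS
    rw [h1, opApply_addOp h3 (hdom t htS.1.le (timeInterval_subset hST htS).2 h3), h2]
    abel
  refine ⟨v, hsol, fun w hw => hw.eqOn hA hA0 hdom hC₁ hC₂ hB hBt hS0 hST hCA hq0 hq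
    (by nlinarith) hsol, hbound, fun t ht => ?_⟩
  have hae : (fun τ => E.toFun (t - τ) (F τ)) =ᵐ[volume.restrict (Ioc 0 t)]
      fun τ => -E.toFun (t - τ) (opApply (B τ) (v τ)) := by
    filter_upwards [hFB.filter_mono (ae_mono (restrict_Ioc_le_timeMeasure ht))] with τ hτ
    rw [hτ, map_neg]
  have hi := C0Semigroup.intervalIntegrable_apply_sub hEa hEc ht.1.le
    (MemLp.intervalIntegrable_of_mem hF ht)
  constructor
  · rw [intervalIntegrable_iff_integrableOn_Ioc_of_le ht.1.le] at hi ⊢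
    have := (hi.congr hae).neg
    exact this.congr (Eventually.of_forall fun τ => neg_neg _)
  · have e : v t = E.toFun t v₀ + ∫ τ in (0 : ℝ)..t, E.toFun (t - τ) (F τ) := rfl
    rw [e, sub_eq_add_neg, ← intervalIntegral.integral_neg, intervalIntegral.integral_of_le ht.1.le,
      intervalIntegral.integral_of_le ht.1.le, integral_congr_ae hae]

lemma existenceTime_pos (hT : 0 < T) (hC₂ : 0 < C₂) (hCA : 0 < CA) :
    0 < existenceTime T C₂ CA := by
  refine lt_min hT (EReal.coe_pos.2 ?_)
  have : 0 < Real.log (1 + 1 / (16 * C₂ ^ 2 * (CA + 1) ^ 2)) :=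
    Real.log_pos (lt_add_of_pos_right _ (by positivity))
  positivity

lemma ofReal_mul_eLpNorm_le_of_existenceTime (hT : 0 < T) (hC₂ : 0 < C₂) (hCA : 0 < CA)
    (hTtop : T < ⊤) (φ : ℝ → H) :
    ENNReal.ofReal C₂ * eLpNorm φ 2 (timeMeasure (existenceTime T C₂ CA)) ≤
      ENNReal.ofReal (1 / (4 * √2) / (CA + 1)) * weightedSup (existenceTime T C₂ CA) φ := by
  have hpos := existenceTime_pos hT hC₂ hCA
  have hle : existenceTime T C₂ CA ≤
      ((1 / 2 * Real.log (1 + 1 / (16 * C₂ ^ 2 * (CA + 1) ^ 2)) : ℝ) : EReal) := min_le_right _ _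
  have htop : existenceTime T C₂ CA ≠ ⊤ := ((min_le_left _ _).trans_lt hTtop).ne
  lift existenceTime T C₂ CA to ℝ using ⟨htop, (EReal.bot_lt_zero.trans hpos).ne'⟩ with s
  have hs : 0 < s := EReal.coe_pos.1 hpos
  have hle' := EReal.coe_le_coe_iff.1 hle
  have hexp : Real.exp (2 * s) ≤ 1 + 1 / (16 * C₂ ^ 2 * (CA + 1) ^ 2) := by
    rw [← Real.exp_log (show 0 < 1 + 1 / (16 * C₂ ^ 2 * (CA + 1) ^ 2) by positivity)]
    exact Real.exp_le_exp.2 (by linarith)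
  have hsqrt : √((Real.exp (2 * s) - 1) / 2) ≤ 1 / (4 * √2) / (CA + 1) / C₂ := by
    rw [Real.sqrt_le_left (by positivity)]
    calc (Real.exp (2 * s) - 1) / 2 ≤ 1 / (16 * C₂ ^ 2 * (CA + 1) ^ 2) / 2 := by linarith
      _ = (1 / (4 * √2) / (CA + 1) / C₂) ^ 2 := by
        rw [div_pow, div_pow, div_pow, mul_pow, Real.sq_sqrt zero_le_two]
        field_simp
        norm_num
  calc _ ≤ ENNReal.ofReal C₂ * (ENNReal.ofReal √((Real.exp (2 * s) - 1) / 2) *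
        weightedSup (s : EReal) φ) := by
        gcongr
        exact eLpNorm_le_sqrt_mul_weightedSup φ hs.le
    _ = ENNReal.ofReal (C₂ * √((Real.exp (2 * s) - 1) / 2)) * weightedSup (s : EReal) φ := by
      rw [ENNReal.ofReal_mul hC₂.le, mul_assoc]
    _ ≤ _ := by
      gcongr
      calc _ ≤ C₂ * (1 / (4 * √2) / (CA + 1) / C₂) := by gcongr
        _ = _ := mul_div_cancel₀ _ hC₂.ne'

end

end

theorem theorem6p3 {H : Type*} [NormedAddCommGroup H] [InnerProductSpace ℂ H] [CompleteSpace H]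
    (T : EReal) (hT : 0 < T)
    (A : H →ₗ.[ℂ] H) (hA : IsSelfAdjoint A) (hA0 : IsNonnegOp A)
    (E : C0Semigroup H) (hE : E.IsGenerator (-A)) (hEc : E.IsContraction)
    (hEa : E.IsBoundedAnalytic)
    (B : ℝ → H →ₗ.[ℂ] H)
    (hdom : ∀ t : ℝ, 0 ≤ t → (t : EReal) < T → A.domain ≤ (B t).domain)
    (C₁ C₂ : ℝ) (hC₁ : 0 < C₁) (hB : RelativelyBounded A B T C₁ C₂) (hBt : TimeRegular A B T) :
    (∃ CA : ℝ, IsMaxRegConst A CA) ∧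
    ∀ CA : ℝ, IsMaxRegConst A CA → C₁ * (CA + 1) < 1 / (4 * Real.sqrt 2) →
      (T < ⊤ → 0 < C₂ → ∀ v₀ : (opSqrt A).domain, ∃ v : ℝ → H,
        IsStrongSolution A B (existenceTime T C₂ CA) v₀ v ∧
        (∀ w : ℝ → H, IsStrongSolution A B (existenceTime T C₂ CA) v₀ w →
          Set.EqOn w v (timeInterval (existenceTime T C₂ CA))) ∧
        normY A (existenceTime T C₂ CA) v
          ≤ ENNReal.ofReal (2 * ‖(v₀ : H)‖ + 2 * Real.sqrt 2 * ‖opSqrt A v₀‖) ∧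
        SatisfiesDuhamel E B (existenceTime T C₂ CA) v₀ v) ∧
      (T = ⊤ → C₂ = 0 → ∀ v₀ : (opSqrt A).domain, ∃ v : ℝ → H,
        IsStrongSolution A B ⊤ v₀ v ∧
        (∀ w : ℝ → H, IsStrongSolution A B ⊤ v₀ w → Set.EqOn w v (timeInterval ⊤)) ∧
        normY A ⊤ v ≤ ENNReal.ofReal (2 * ‖(v₀ : H)‖ + 2 * Real.sqrt 2 * ‖opSqrt A v₀‖) ∧
        SatisfiesDuhamel E B ⊤ v₀ v) := by
  refine ⟨⟨√2, isMaxRegConst_sqrt_two hA hA0⟩, fun CA hCA hsmall => ⟨fun hTtop hC₂ v₀ => ?_,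
    fun hTtop hC₂ v₀ => ?_⟩⟩
  · exact wellPosed_of_small hA hA0 hE hEc hEa hdom hC₁ hC₂.le hB hBt
      (existenceTime_pos hT hC₂ hCA.1) (min_le_left _ _) hCA hsmall
      (ofReal_mul_eLpNorm_le_of_existenceTime hT hC₂ hCA.1 hTtop) v₀
  · subst hTtop hC₂
    exact wellPosed_of_small hA hA0 hE hEc hEa hdom hC₁ le_rfl hB hBt hT le_rfl hCA hsmall
      (fun φ => by simp) v₀
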